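/- **Conventions.** A function $F:[0,\infty]^4\to[0,\infty]$ is *admissible* if it is increasing for the product order, finite at finite arguments, and $x l_y+y l_x\le F(x,y,l_x,l_y)$ for all $x,y,l_x,l_y\ge 0$. An *$F$-quasi-Leibniz quantum compact metric space* $(\mathfrak A,\mathsf L)$ is a (nonzero) unital C*-algebra $\mathfrak A$ with a seminorm $\mathsf L$ defined on a dense Jordan–Lie subalgebra $\operatorname{dom}(\mathsf L)$ of the self-adjoint part $\mathfrak{sa}(\mathfrak A)$ (put $\mathsf L=\infty$ on the rest of $\mathfrak{sa}(\mathfrak A)$) such that: $\{a:\mathsf L(a)=0\}=\mathbb R 1_{\mathfrak A}$; the Monge–Kantorovich metric $\mathsf{mk}_{\mathsf L}(\varphi,\psi)=\sup\{|\varphi(a)-\psi(a)|:\mathsf L(a)\le 1\}$ metrizes the weak* topology of the state space $\mathscr S(\mathfrak A)$; $\max\{\mathsf L(\tfrac{ab+ba}{2}),\mathsf L(\tfrac{ab-ba}{2i})\}\le F(\|a\|,\|b\|,\mathsf L(a),\mathsf L(b))$ for $a,b\in\operatorname{dom}(\mathsf L)$; and $\mathsf L$ is lower semicontinuous on $\mathfrak{sa}(\mathfrak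 A)$ for the norm. A *quantum isometry* $\pi:(\mathfrak D,\mathsf L_{\mathfrak D})\to(\mathfrak A,\mathsf L_{\mathfrak A})$ is a surjective *-homomorphism with $\mathsf L_{\mathfrak A}(a)=\inf\{\mathsf L_{\mathfrak D}(d):d\in\mathfrak{sa}(\mathfrak D),\ \pi(d)=a\}$ for all $a\in\mathfrak{sa}(\mathfrak A)$; a *full quantum isometry* is a *-isomorphism $\pi$ with $\mathsf L_{\mathfrak A}\circ\pi=\mathsf L_{\mathfrak D}$. An *$F$-tunnel* $\tau=(\mathfrak D,\mathsf L,\pi_1,\pi_2)$ with domain $(\mathfrak A_1,\mathsf L_1)$ and codomain $(\mathfrak A_2,\mathsf L_2)$ consists of an $F$-quasi-Leibniz quantum compact metric space $(\mathfrak D,\mathsf L)$ and quantum isometries $\pi_j$ from it onto $(\mathfrak A_j,\mathsf L_j)$, $j=1,2$; its *extent* $\chi(\tau)$ is the maximum over $j=1,2$ of the Hausdorff distance for $\mathsf{mk}_{\mathsf L}$ between $\mathscr S(\mathfrak D)$ and $\{\psi\circ\pi_j:\psi\in\mathscr S(\mathfrak A_j)\}$. A class $\mathcal T$ of $F$-tunnels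 is *appropriate* for a nonempty class $\mathcal C$ of $F$-quasi-Leibniz quantum compact metric spaces if: (i) tunnels in $\mathcal T$ have domain and codomain in $\mathcal C$; (ii) any two members of $\mathcal C$ are the domain and codomain of some tunnel in $\mathcal T$; (iii) $(\mathfrak D,\mathsf L,\pi,\rho)\in\mathcal T$ implies $(\mathfrak D,\mathsf L,\rho,\pi)\in\mathcal T$; (iv) for every full quantum isometry $h:(\mathfrak A,\mathsf L_{\mathfrak A})\to(\mathfrak B,\mathsf L_{\mathfrak B})$ between members of $\mathcal C$, the tunnels $(\mathfrak A,\mathsf L_{\mathfrak A},\mathrm{id},h)$ and $(\mathfrak B,\mathsf L_{\mathfrak B},h^{-1},\mathrm{id})$ are in $\mathcal T$; (v) for $\tau,\gamma\in\mathcal T$ with the codomain of $\tau$ equal to the domain of $\gamma$ and every $\varepsilon>0$, there is $\sigma\in\mathcal T$ with the domain of $\tau$, the codomain of $\gamma$, and $\chi(\sigma)<\chi(\tau)+\chi(\gamma)+\varepsilon$. The *dual $\mathcal T$-propinquity* $\mathsf\Lambda^*_{\mathcal T}$ between two members of $\mathcal C$ is the infimum of $\chi(\tau)$ over all $\tau\in\mathcal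 T$ from the first to the second. For a *-automorphism $\theta$ of $\mathfrak A$, put $\mathsf{mk}\ell_{\mathsf L}(\theta)=\sup\{\|a-\theta(a)\|_{\mathfrak A}:\mathsf L(a)\le 1\}$; $\theta$ is *Lipschitz* if it maps $\operatorname{dom}(\mathsf L)$ into itself. An inequality $\mathsf L\circ\theta\le k\,\mathsf L$ is understood on $\operatorname{dom}(\mathsf L)$. An action $\alpha$ of a group $G$ on $\mathfrak A$ by *-automorphisms is *ergodic* if $\{a\in\mathfrak A:\alpha^g(a)=a\ \text{for all } g\in G\}=\mathbb C1_{\mathfrak A}$. For $\varepsilon>0$, a pair of maps $\varsigma_1:G_1\to G_2$, $\varsigma_2:G_2\to G_1$ between metric groups $(G_1,\delta_1)$, $(G_2,\delta_2)$ with units $e_1,e_2$ is an *$\varepsilon$-near isometric isomorphism* from $G_1$ to $G_2$ if for $\{j,k\}=\{1,2\}$ and $g,g'\in G_j$: $\delta_k(\varsigma_j(g)\varsigma_j(g'),\varsigma_j(gg'))\le\varepsilon$, $\delta_j(\varsigma_k(\varsigma_j(g)),g)\le\varepsilon$, $|\delta_k(\varsigma_j(g),\varsigma_j(g'))-\delta_j(g,g')|\le\varepsilon$,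 and $\delta_k(\varsigma_j(e_j),e_k)\le\varepsilon$. **Theorem.** Let $(G,\delta_G)$ and $(G_n,\delta_n)$, $n\in\mathbb N$, be compact metric groups. Let $(\varepsilon_n)_{n\in\mathbb N}$ be positive numbers with $\lim_n\varepsilon_n=0$ and, for each $n$, let $(\varsigma_n,\varkappa_n)$ be an $\varepsilon_n$-near isometric isomorphism from $(G_n,\delta_n)$ to $(G,\delta_G)$. Let $D:G\to[0,\infty)$ be continuous, and let $K:[0,\infty)\to[0,\infty)$ be continuous with $K(0)=0$. Let $F$ be admissible, $\mathcal C$ a nonempty class of $F$-quasi-Leibniz quantum compact metric spaces, and $\mathcal T$ a class of $F$-tunnels appropriate for $\mathcal C$. Let $(\mathfrak A_n,\mathsf L_n)_{n\in\mathbb N}$ be a sequence in $\mathcal C$ and, for each $n$, let $\alpha_n$ be an action of $G_n$ on $\mathfrak A_n$ by Lipschitz *-automorphisms such that for all $g,g'\in G_n$ and $a\in\operatorname{dom}(\mathsf L_n)$ $$\mathsf L_n\circ\alpha_n^g\le D(\varsigma_n(g))\,\mathsf L_n\quad\text{and}\quad \|\alpha_n^g(a)-\alpha_n^{g'}(a)\|_{\mathfrak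 A_n}\le K(\delta_n(g,g'))\,\mathsf L_n(a).$$ If $(\mathfrak A,\mathsf L)\in\mathcal C$ satisfies $\lim_n\mathsf\Lambda^*_{\mathcal T}((\mathfrak A_n,\mathsf L_n),(\mathfrak A,\mathsf L))=0$, then there is a strongly continuous action $\alpha$ of $G$ on $\mathfrak A$ by Lipschitz *-automorphisms such that for all $g,h\in G$ and $a\in\operatorname{dom}(\mathsf L)$ $$\mathsf L\circ\alpha^g\le D(g)\,\mathsf L,\qquad \|\alpha^g(a)-\alpha^h(a)\|_{\mathfrak A}\le \mathsf L(a)\,K(\delta_G(g,h)),$$ $$\liminf_{n\to\infty}\mathsf{mk}\ell_{\mathsf L_n}\big(\alpha_n^{\varkappa_n(g)}\big)\le\mathsf{mk}\ell_{\mathsf L}(\alpha^g)\le\limsup_{n\to\infty}\mathsf{mk}\ell_{\mathsf L_n}\big(\alpha_n^{\varkappa_n(g)}\big).$$ Furthermore, this action $\alpha$ satisfies: 1. if $D\le 1$, then $\alpha^g$ is a full quantum isometry of $(\mathfrak A,\mathsf L)$ for every $g\in G$; 2. if $\alpha_n$ is ergodic for every $n\in\mathbb N$, then $\alpha$ is ergodic.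 -/

import Mathlib

open Filter Topology
open scoped ENNReal NNReal ComplexOrder ComplexStarModule

namespace QMetric

noncomputable section

/-- Admissible functions `F : [0,∞]⁴ → [0,∞]`: finite at finite arguments, increasing for the
product order, and bounding the Leibniz expression `x l_y + y l_x` from above. -/
structure IsAdmissible (F : ℝ≥0∞ → ℝ≥0∞ → ℝ≥0∞ → ℝ≥0∞ → ℝ≥0∞) : Prop where
  mono : ∀ ⦃x x' y y' lx lx' ly ly' : ℝ≥0∞⦄, x ≤ x' → y ≤ y' → lx ≤ lx' → ly ≤ ly' →
    F x y lx ly ≤ F x' y' lx' ly'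
  leibniz_le : ∀ x y lx ly : ℝ≥0∞, x * ly + y * lx ≤ F x y lx ly
  finite : ∀ x y lx ly : ℝ≥0, F x y lx ly ≠ ∞

section Algebra

variable {A : Type*} [CStarAlgebra A]

/-- The Jordan product `(ab + ba) / 2`, i.e. the real part of `ab`. -/
def jordan (a b : selfAdjoint A) : selfAdjoint A := ℜ ((a : A) * (b : A))

/-- The Lie product `(ab - ba) / (2i)`, i.e. the imaginary part of `ab`. -/
def lie (a b : selfAdjoint A) : selfAdjoint A := ℑ ((a : A) * (b : A))

theorem coe_jordan (a b : selfAdjoint A) :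
    (jordan a b : A) = (2 : ℂ)⁻¹ • ((a : A) * b + b * a) := by
  have ha : star (a : A) = a := a.2
  have hb : star (b : A) = b := b.2
  rw [jordan, realPart_apply_coe, star_mul, ha, hb, ← Complex.coe_smul]
  simp

theorem coe_lie (a b : selfAdjoint A) :
    (lie a b : A) = (2 * Complex.I)⁻¹ • ((a : A) * b - b * a) := by
  have ha : star (a : A) = a := a.2
  have hb : star (b : A) = b := b.2
  rw [lie, imaginaryPart_apply_coe, star_mul, ha, hb, ← Complex.coe_smul, smul_smul]
  congr 1
  simp [mul_comm]

variable (A) in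
/-- The state space of a unital C*-algebra, with the weak* topology (the subspace topology). -/
abbrev State : Type _ :=
  {φ : WeakDual ℂ A // (∀ a : A, 0 ≤ φ (star a * a)) ∧ φ 1 = 1}

/-- The Monge-Kantorovich metric of `L`: the supremum of `|φ(a) - ψ(a)|` over self-adjoint `a`
with `L(a) ≤ 1`. -/
def mkDist (L : selfAdjoint A → ℝ≥0∞) (φ ψ : State A) : ℝ≥0∞ :=
  ⨆ (a : selfAdjoint A) (_ : L a ≤ 1), ‖φ.1 (a : A) - ψ.1 (a : A)‖ₑ

/-- The state space as an (extended, pseudo) metric space for the Monge-Kantorovich metric. -/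
abbrev mkPseudoEMetric (L : selfAdjoint A → ℝ≥0∞) : PseudoEMetricSpace (State A) where
  edist := mkDist L
  edist_self φ := by simp [mkDist]
  edist_comm φ ψ := by simp only [mkDist, ← enorm_neg (φ.1 _ - ψ.1 _), neg_sub]
  edist_triangle φ ψ χ := by
    refine iSup₂_le fun a ha => ?_
    calc ‖φ.1 (a : A) - χ.1 (a : A)‖ₑ
        = ‖(φ.1 (a : A) - ψ.1 (a : A)) + (ψ.1 (a : A) - χ.1 (a : A))‖ₑ := by
          rw [sub_add_sub_cancel]
      _ ≤ ‖φ.1 (a : A) - ψ.1 (a : A)‖ₑ + ‖ψ.1 (a : A) - χ.1 (a : A)‖ₑ := enorm_add_le _ _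
      _ ≤ _ := add_le_add
          (le_iSup₂ (f := fun (a : selfAdjoint A) (_ : L a ≤ 1) =>
            ‖φ.1 (a : A) - ψ.1 (a : A)‖ₑ) a ha)
          (le_iSup₂ (f := fun (a : selfAdjoint A) (_ : L a ≤ 1) =>
            ‖ψ.1 (a : A) - χ.1 (a : A)‖ₑ) a ha)

/-- `L` is an `F`-quasi-Leibniz L-seminorm on the unital C*-algebra `A`. The seminorm is extended
by `L a = ∞` off its domain, so that `dom L = {a | L a ≠ ∞}`. Since `F` is finite at finite
arguments, `quasiLeibniz` makes `dom L` a Jordan-Lie subalgebra. -/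
structure IsLSeminorm (F : ℝ≥0∞ → ℝ≥0∞ → ℝ≥0∞ → ℝ≥0∞ → ℝ≥0∞)
    (L : selfAdjoint A → ℝ≥0∞) : Prop where
  add_le : ∀ a b, L (a + b) ≤ L a + L b
  smul_eq : ∀ (r : ℝ) (a), L (r • a) = ‖r‖ₑ * L a
  dense_dom : Dense {a : selfAdjoint A | L a ≠ ∞}
  eq_zero_iff : ∀ a, L a = 0 ↔ ∃ t : ℝ, (a : A) = algebraMap ℂ A (t : ℂ)
  mkDist_ne_top : ∀ φ ψ : State A, mkDist L φ ψ ≠ ∞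
  metrizes_weakStar :
    (mkPseudoEMetric L).toUniformSpace.toTopologicalSpace
      = (inferInstance : TopologicalSpace (State A))
  quasiLeibniz : ∀ a b, L a ≠ ∞ → L b ≠ ∞ →
    max (L (jordan a b)) (L (lie a b)) ≤ F ‖(a : A)‖ₑ ‖(b : A)‖ₑ (L a) (L b)
  lowerSemicontinuous : LowerSemicontinuous L

end Algebra

/-- `F`-quasi-Leibniz quantum compact metric spaces. -/
structure QCMS.{u} (F : ℝ≥0∞ → ℝ≥0∞ → ℝ≥0∞ → ℝ≥0∞ → ℝ≥0∞) : Type (u + 1) where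
  carrier : Type u
  [cstar : CStarAlgebra carrier]
  [nontriv : Nontrivial carrier]
  L : selfAdjoint carrier → ℝ≥0∞
  isLSeminorm : IsLSeminorm F L

attribute [instance] QCMS.cstar QCMS.nontriv

instance (F : ℝ≥0∞ → ℝ≥0∞ → ℝ≥0∞ → ℝ≥0∞ → ℝ≥0∞) : CoeSort (QCMS F) (Type _) :=
  ⟨QCMS.carrier⟩

section Morphisms

variable {A B : Type*} [CStarAlgebra A] [CStarAlgebra B]

/-- The action of a unital *-homomorphism on self-adjoint elements. -/
def saMap (π : A →⋆ₐ[ℂ] B) (a : selfAdjoint A) : selfAdjoint B :=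
  ⟨π a, IsSelfAdjoint.map a.2 π⟩

/-- A unital *-homomorphism is a Lipschitz morphism when it maps `dom L_A` into `dom L_B`. -/
def IsLipschitz (LA : selfAdjoint A → ℝ≥0∞) (LB : selfAdjoint B → ℝ≥0∞)
    (π : A →⋆ₐ[ℂ] B) : Prop :=
  ∀ a : selfAdjoint A, LA a ≠ ∞ → LB (saMap π a) ≠ ∞

/-- The inequality `L_B ∘ π ≤ k L_A`. It is void at `a ∉ dom L_A`, where `L_A a = ∞`. -/
def LipschitzBound (k : ℝ≥0) (LA : selfAdjoint A → ℝ≥0∞) (LB : selfAdjoint B → ℝ≥0∞)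
    (π : A →⋆ₐ[ℂ] B) : Prop :=
  ∀ a : selfAdjoint A, LA a ≠ ∞ → LB (saMap π a) ≤ k * LA a

/-- Quantum isometries: *-epimorphisms for which `L_B` is the quotient seminorm of `L_A`. -/
structure IsQuantumIsometry (LA : selfAdjoint A → ℝ≥0∞) (LB : selfAdjoint B → ℝ≥0∞)
    (π : A →⋆ₐ[ℂ] B) : Prop where
  surjective : Function.Surjective π
  quotient_eq : ∀ b : selfAdjoint B, LB b = ⨅ (a : selfAdjoint A) (_ : saMap π a = b), LA a

/-- Full quantum isometries: *-isomorphisms `π` with `L_B ∘ π = L_A`. -/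
def IsFullQuantumIsometry (LA : selfAdjoint A → ℝ≥0∞) (LB : selfAdjoint B → ℝ≥0∞)
    (π : A ≃⋆ₐ[ℂ] B) : Prop :=
  ∀ a : selfAdjoint A, LB (saMap (π : A →⋆ₐ[ℂ] B) a) = LA a

/-- The Monge-Kantorovich length of an automorphism: the supremum of `‖a - π(a)‖` over
self-adjoint `a` with `L(a) ≤ 1`. -/
def mkLength (L : selfAdjoint A → ℝ≥0∞) (π : A ≃⋆ₐ[ℂ] A) : ℝ≥0∞ :=
  ⨆ (a : selfAdjoint A) (_ : L a ≤ 1), ‖(a : A) - π (a : A)‖ₑ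

theorem IsFullQuantumIsometry.isQuantumIsometry {LA : selfAdjoint A → ℝ≥0∞}
    {LB : selfAdjoint B → ℝ≥0∞} {π : A ≃⋆ₐ[ℂ] B} (h : IsFullQuantumIsometry LA LB π) :
    IsQuantumIsometry LA LB (π : A →⋆ₐ[ℂ] B) where
  surjective := π.surjective
  quotient_eq b := by
    refine le_antisymm (le_iInf₂ fun a ha => ?_) ?_
    · rw [← ha, h a]
    · have hb : saMap (π : A →⋆ₐ[ℂ] B) (saMap (π.symm : B →⋆ₐ[ℂ] A) b) = b :=
        Subtype.ext (π.apply_symm_apply (b : B))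
      calc _ ≤ LA (saMap (π.symm : B →⋆ₐ[ℂ] A) b) :=
            iInf₂_le (f := fun (a : selfAdjoint A) (_ : saMap (π : A →⋆ₐ[ℂ] B) a = b) => LA a) _ hb
        _ = LB b := by rw [← h, hb]

theorem IsFullQuantumIsometry.symm {LA : selfAdjoint A → ℝ≥0∞}
    {LB : selfAdjoint B → ℝ≥0∞} {π : A ≃⋆ₐ[ℂ] B} (h : IsFullQuantumIsometry LA LB π) :
    IsFullQuantumIsometry LB LA π.symm := fun b => by
  have hb : saMap (π : A →⋆ₐ[ℂ] B) (saMap (π.symm : B →⋆ₐ[ℂ] A) b) = b :=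
    Subtype.ext (π.apply_symm_apply (b : B))
  rw [← h, hb]

theorem isQuantumIsometry_id (LA : selfAdjoint A → ℝ≥0∞) :
    IsQuantumIsometry LA LA (StarAlgHom.id ℂ A) where
  surjective := Function.surjective_id
  quotient_eq b := le_antisymm
    (le_iInf₂ fun _ ha => le_of_eq (congrArg LA ha.symm))
    (iInf₂_le (f := fun (a : selfAdjoint A) (_ : saMap (StarAlgHom.id ℂ A) a = b) => LA a) b rfl)

end Morphisms

section Tunnels

variable {F : ℝ≥0∞ → ℝ≥0∞ → ℝ≥0∞ → ℝ≥0∞ → ℝ≥0∞}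

/-- `F`-tunnels with domain `A` and codomain `B`. -/
structure Tunnel.{u} (A B : QCMS.{u} F) : Type (u + 1) where
  space : QCMS.{u} F
  fst : space →⋆ₐ[ℂ] A
  snd : space →⋆ₐ[ℂ] B
  fst_isometry : IsQuantumIsometry space.L A.L fst
  snd_isometry : IsQuantumIsometry space.L B.L snd

/-- The inverse tunnel `(D, L, ρ, π)` of `(D, L, π, ρ)`. -/
def Tunnel.inv {A B : QCMS F} (τ : Tunnel A B) : Tunnel B A :=
  ⟨τ.space, τ.snd, τ.fst, τ.snd_isometry, τ.fst_isometry⟩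

/-- The tunnel `(A, L_A, id, h)` of a full quantum isometry `h`. -/
def Tunnel.ofIso {A B : QCMS F} (h : A ≃⋆ₐ[ℂ] B) (hh : IsFullQuantumIsometry A.L B.L h) :
    Tunnel A B :=
  ⟨A, StarAlgHom.id ℂ A, h, isQuantumIsometry_id _, hh.isQuantumIsometry⟩

/-- The tunnel `(B, L_B, h⁻¹, id)` of a full quantum isometry `h`. -/
def Tunnel.ofIsoSymm {A B : QCMS F} (h : A ≃⋆ₐ[ℂ] B) (hh : IsFullQuantumIsometry A.L B.L h) :
    Tunnel A B :=
  ⟨B, h.symm, StarAlgHom.id ℂ B, hh.symm.isQuantumIsometry, isQuantumIsometry_id _⟩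

/-- The set `π^*(S(A))` of all states `ψ ∘ π` of `D`, where `ψ` is a state of `A`. -/
def pulledBackStates {D A : Type*} [CStarAlgebra D] [CStarAlgebra A] (π : D →⋆ₐ[ℂ] A) :
    Set (State D) :=
  {φ | ∃ ψ : State A, ∀ d : D, φ.1 d = ψ.1 (π d)}

/-- The extent of a tunnel: the larger of the two Hausdorff distances, for the Monge-Kantorovich
metric of `L_D`, between `S(D)` and the sets of states pulled back from the two ends. -/
def Tunnel.extent {A B : QCMS F} (τ : Tunnel A B) : ℝ≥0∞ :=
  max
    (@Metric.hausdorffEDist (State τ.space) (mkPseudoEMetric τ.space.L)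
      Set.univ (pulledBackStates τ.fst))
    (@Metric.hausdorffEDist (State τ.space) (mkPseudoEMetric τ.space.L)
      Set.univ (pulledBackStates τ.snd))

/-- A class of `F`-tunnels, sorted by domain and codomain. -/
abbrev TunnelClass.{u} (F : ℝ≥0∞ → ℝ≥0∞ → ℝ≥0∞ → ℝ≥0∞ → ℝ≥0∞) : Type (u + 1) :=
  ∀ A B : QCMS.{u} F, Set (Tunnel A B)

/-- A class of tunnels is appropriate for a nonempty class of `F`-quasi-Leibniz quantum compact
metric spaces. -/
structure IsAppropriate.{u} (T : TunnelClass.{u} F) (C : Set (QCMS.{u} F)) : Prop where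
  nonempty : C.Nonempty
  mem_of_mem : ∀ ⦃A B : QCMS.{u} F⦄ ⦃τ : Tunnel A B⦄, τ ∈ T A B → A ∈ C ∧ B ∈ C
  exists_tunnel : ∀ ⦃A B : QCMS.{u} F⦄, A ∈ C → B ∈ C → (T A B).Nonempty
  inv_mem : ∀ ⦃A B : QCMS.{u} F⦄ ⦃τ : Tunnel A B⦄, τ ∈ T A B → τ.inv ∈ T B A
  iso_mem : ∀ ⦃A B : QCMS.{u} F⦄, A ∈ C → B ∈ C →
    ∀ (h : A ≃⋆ₐ[ℂ] B) (hh : IsFullQuantumIsometry A.L B.L h),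
      Tunnel.ofIso h hh ∈ T A B ∧ Tunnel.ofIsoSymm h hh ∈ T A B
  comp_mem : ∀ ⦃A B E : QCMS.{u} F⦄ ⦃τ : Tunnel A B⦄ ⦃γ : Tunnel B E⦄, τ ∈ T A B → γ ∈ T B E →
    ∀ ε : ℝ≥0, 0 < ε → ∃ σ ∈ T A E, σ.extent < τ.extent + γ.extent + ε

/-- The dual `T`-propinquity: the infimum of the extents of the tunnels in `T` from `A` to `B`. -/
def propinquity.{u} (T : TunnelClass.{u} F) (A B : QCMS.{u} F) : ℝ≥0∞ :=
  ⨅ τ ∈ T A B, τ.extent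

end Tunnels

/-- `(s₁, s₂)` is an `ε`-near isometric isomorphism between the metric groups `G₁` and `G₂`. -/
structure IsNearIsometricIso {G₁ G₂ : Type*} [Group G₁] [MetricSpace G₁] [Group G₂]
    [MetricSpace G₂] (ε : ℝ) (s₁ : G₁ → G₂) (s₂ : G₂ → G₁) : Prop where
  mul₁ : ∀ g g' : G₁, dist (s₁ g * s₁ g') (s₁ (g * g')) ≤ ε
  mul₂ : ∀ g g' : G₂, dist (s₂ g * s₂ g') (s₂ (g * g')) ≤ ε
  inv₁ : ∀ g : G₁, dist (s₂ (s₁ g)) g ≤ ε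
  inv₂ : ∀ g : G₂, dist (s₁ (s₂ g)) g ≤ ε
  dist₁ : ∀ g g' : G₁, |dist (s₁ g) (s₁ g') - dist g g'| ≤ ε
  dist₂ : ∀ g g' : G₂, |dist (s₂ g) (s₂ g') - dist g g'| ≤ ε
  one₁ : dist (s₁ 1) 1 ≤ ε
  one₂ : dist (s₂ 1) 1 ≤ ε

/-- An action by *-automorphisms is ergodic when its fixed points are the scalars. -/
def IsErgodic {G A : Type*} [Group G] [CStarAlgebra A] (α : G →* (A ≃⋆ₐ[ℂ] A)) : Prop :=
  {a : A | ∀ g : G, α g a = a} = Set.range (algebraMap ℂ A)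

end

end QMetric

universe u v w

namespace QMetric

/-! ### States: positivity, norm of self-adjoint elements, weak* compactness -/

section States

variable {A : Type*} [CStarAlgebra A]

/-! The action on the limit is an ultralimit of the given actions, transported through tunnels.
Choose tunnels from `As n` to `A` whose extents tend to zero (`exists_tunnels_of_propinquity`) and a
nonprincipal ultrafilter `U` on the naturals. The relation `Rep U τ a x` says that the sequence `x`
converges to `a` through these tunnels, up to arbitrarily small errors, by lifts of uniformly
bounded seminorm. An ultrafilter gives limits for all elements and all group elements at once, with
no passage to subsequences.

Small extent means that an element of a tunnel with bounded seminorm has nearly the norm of its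
image at either end, because every state is close to one that factors through that end
(`IsLSeminorm.norm_le_of_hausdorffEDist_lt`). Hence `Rep` determines `a` from `x`, and `x` from `a`
up to a null sequence. The quasi-Leibniz inequality makes it compatible with products (`Rep.mul`),
and every `a` has a representative (`exists_rep`). In the other direction, sequences bounded in norm
and seminorm do represent something (`exists_rep_of_lift_le`), because elements of `A` bounded in
norm and seminorm form a relatively compact set (`IsLSeminorm.exists_tendsto`). Uniformly Lipschitz
endomorphisms preserve such sequences, so they induce an endomorphism of `A` (`exists_starAlgHom`).

Applied to `αs n (ϰ n g)`, this gives a family of endomorphisms indexed by `G`. The maps `ϰ n` are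
multiplicative up to a vanishing error, which the modulus `K` turns into an error of the actions
vanishing relative to the seminorm, so the family is an action (`exists_limit_action`). The
Lipschitz bounds survive by lower semicontinuity, and the norm estimates by the sharp comparison
`Rep.norm_le_of_selfAdjoint`. For ergodicity, a representative of a fixed point is almost fixed by
all of `Gs n`, uniformly, thanks to a finite net in `G` and equicontinuity. Averaging over Haar
measure then shows that it is almost scalar (`isErgodic_of_rep`). -/

theorem exists_star_mul_self_eq_norm_add {a : A} (ha : IsSelfAdjoint a) :
    ∃ b : A, algebraMap ℝ A ‖a‖ + a = star b * b := by
  let := CStarAlgebra.spectralOrder A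
  let := CStarAlgebra.spectralOrderedRing A
  refine CStarAlgebra.nonneg_iff_eq_star_mul_self.1 ?_
  have h := ha.neg_algebraMap_norm_le_self
  rwa [neg_le_iff_add_nonneg'] at h

theorem State.map_real (φ : State A) (r : ℝ) : φ.1 (algebraMap ℝ A r) = (r : ℂ) := by
  have : (algebraMap ℝ A r) = (r : ℂ) • (1 : A) := by
    rw [Algebra.algebraMap_eq_smul_one, Complex.coe_smul]
  rw [this, map_smul, φ.2.2, smul_eq_mul, mul_one]

theorem State.map_complex (φ : State A) (z : ℂ) : φ.1 (algebraMap ℂ A z) = z := by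
  rw [Algebra.algebraMap_eq_smul_one, map_smul, φ.2.2, smul_eq_mul, mul_one]

theorem State.neg_norm_le {a : A} (φ : State A) (ha : IsSelfAdjoint a) :
    -(‖a‖ : ℂ) ≤ φ.1 a := by
  obtain ⟨b, hb⟩ := exists_star_mul_self_eq_norm_add ha
  have h := φ.2.1 b
  rw [← hb, map_add, φ.map_real] at h
  rwa [neg_le_iff_add_nonneg']

theorem State.map_selfAdjoint {a : A} (φ : State A) (ha : IsSelfAdjoint a) :
    φ.1 a = ((φ.1 a).re : ℂ) := by
  have h := (Complex.le_def.1 (φ.neg_norm_le ha)).2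
  apply Complex.ext <;> simp at h ⊢
  exact h.symm

theorem State.norm_apply_le_of_selfAdjoint {a : A} (φ : State A) (ha : IsSelfAdjoint a) :
    ‖φ.1 a‖ ≤ ‖a‖ := by
  have h1 := (Complex.le_def.1 (φ.neg_norm_le ha)).1
  have h2 := (Complex.le_def.1 (φ.neg_norm_le ha.neg)).1
  rw [φ.map_selfAdjoint ha, Complex.norm_real, Real.norm_eq_abs, abs_le]
  simp only [map_neg, norm_neg, Complex.neg_re, Complex.ofReal_re] at h1 h2
  exact ⟨h1, by linarith⟩

/-- After multiplying `a` by a phase the value is a nonnegative real, hence it is the value at the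
real part, where the self-adjoint bound applies. -/
theorem State.norm_apply_le (φ : State A) (a : A) : ‖φ.1 a‖ ≤ ‖a‖ := by
  obtain ⟨c, hc, hca⟩ : ∃ c : ℂ, ‖c‖ = 1 ∧ φ.1 (c • a) = (‖φ.1 a‖ : ℂ) := by
    obtain ⟨c, hc, h⟩ := RCLike.exists_norm_eq_mul_self (φ.1 a)
    exact ⟨c, hc, by rw [map_smul, smul_eq_mul, ← h]; rfl⟩
  have hre : φ.1 (c • a) = φ.1 (ℜ (c • a) : A) + Complex.I * φ.1 (ℑ (c • a) : A) := by
    have h := congrArg φ.1 (realPart_add_I_smul_imaginaryPart (c • a))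
    rw [map_add φ.1, map_smul φ.1, smul_eq_mul] at h
    exact h.symm
  rw [hca, φ.map_selfAdjoint (ℜ (c • a)).2, φ.map_selfAdjoint (ℑ (c • a)).2] at hre
  have hre' := congrArg Complex.re hre
  simp only [Complex.ofReal_re, Complex.add_re, Complex.mul_re, Complex.I_re, Complex.I_im,
    Complex.ofReal_im, zero_mul, mul_zero, sub_zero, add_zero] at hre'
  calc ‖φ.1 a‖ = (φ.1 (ℜ (c • a) : A)).re := hre'
    _ ≤ ‖φ.1 (ℜ (c • a) : A)‖ := Complex.re_le_norm _
    _ ≤ ‖(ℜ (c • a) : A)‖ := φ.norm_apply_le_of_selfAdjoint (ℜ (c • a)).2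
    _ ≤ ‖c • a‖ := (realPart.norm_le (c • a) :)
    _ = ‖a‖ := by rw [norm_smul, hc, one_mul]

/-- Banach–Alaoglu: states form a weak* closed subset of the dual unit ball. -/
instance : CompactSpace (State A) := by
  refine isCompact_iff_compactSpace.1 ?_
  refine (WeakDual.isCompact_closedBall (𝕜 := ℂ) (E := A) 0 1).of_isClosed_subset ?_ ?_
  · have h1 : IsClosed {φ : WeakDual ℂ A | ∀ a : A, 0 ≤ φ (star a * a)} := by
      simp only [Set.ofPred_forall]
      exact isClosed_iInter fun a => isClosed_le continuous_const (WeakDual.eval_continuous _)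
    have h2 : IsClosed {φ : WeakDual ℂ A | φ 1 = 1} :=
      isClosed_eq (WeakDual.eval_continuous _) continuous_const
    exact h1.inter h2
  · intro φ hφ
    rw [Set.mem_preimage, mem_closedBall_zero_iff]
    refine ContinuousLinearMap.opNorm_le_bound _ zero_le_one fun a => ?_
    rw [one_mul]
    exact State.norm_apply_le ⟨φ, hφ⟩ a

/-- A contractive unital functional is a state. -/
theorem nonneg_of_norm_le_one [Nontrivial A] {f : A →L[ℂ] ℂ} (hf : ‖f‖ ≤ 1) (h1 : f 1 = 1) (a : A) :
    0 ≤ f (star a * a) := by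
  have hle : ∀ x, ‖f x‖ ≤ ‖x‖ := fun x => (f.le_opNorm x).trans
    (mul_le_of_le_one_left (norm_nonneg _) hf)
  have hs : IsSelfAdjoint (star a * a) := IsSelfAdjoint.star_mul_self a
  set b := star a * a with hb
  have him : (f b).im = 0 := by
    by_contra hne
    -- Evaluate at `b + it`: the C*-identity bounds its squared norm by `‖b‖² + t²`, while the
    -- imaginary part of the value is shifted by `t`. A nonzero imaginary part leaves a term linear
    -- in `t` on the left, which is unbounded.
    have key : ∀ t : ℝ, ((f b).im + t) ^ 2 ≤ ‖b‖ ^ 2 + t ^ 2 := by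
      intro t
      have hx : f (b + (t * Complex.I) • (1 : A)) = f b + t * Complex.I := by
        rw [map_add, map_smul, h1, smul_eq_mul, mul_one]
      have e1 : ‖b + (t * Complex.I) • (1 : A)‖ ^ 2 ≤ ‖b‖ ^ 2 + t ^ 2 := by
        have : star (b + (t * Complex.I) • (1 : A)) * (b + (t * Complex.I) • (1 : A))
            = b * b + ((t : ℂ) ^ 2) • (1 : A) := by
          rw [star_add, star_smul, star_one, hs.star_eq]
          simp only [add_mul, mul_add, smul_mul_assoc, one_mul, mul_smul_comm, mul_one, smul_add,
            smul_smul, Complex.star_def, map_mul, Complex.conj_ofReal, Complex.conj_I]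
          have e : (t : ℂ) * Complex.I * (t * -Complex.I) = (t : ℂ) ^ 2 := by
            linear_combination (-(t : ℂ) ^ 2) * Complex.I_sq
          rw [e]
          module
        rw [sq, ← CStarRing.norm_star_mul_self, this]
        refine (norm_add_le _ _).trans (add_le_add ?_ ?_)
        · rw [sq]; exact norm_mul_le _ _
        · rw [norm_smul, norm_one, mul_one, norm_pow, Complex.norm_real, Real.norm_eq_abs, sq_abs]
      have e2 : ((f b).im + t) ^ 2 ≤ ‖f b + t * Complex.I‖ ^ 2 := by
        have := Complex.abs_im_le_norm (f b + t * Complex.I)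
        rw [← sq_abs]
        refine pow_le_pow_left₀ (abs_nonneg _) ?_ 2
        simpa using this
      refine e2.trans (le_trans ?_ e1)
      rw [← hx]
      exact pow_le_pow_left₀ (norm_nonneg _) (hle _) 2
    -- This `t` makes the cross term equal to `2‖b‖²`, already more than the right side allows.
    have h := key ((‖b‖ ^ 2) / (f b).im)
    have e : ((f b).im + ‖b‖ ^ 2 / (f b).im) ^ 2
      = (f b).im ^ 2 + 2 * ‖b‖ ^ 2 + (‖b‖ ^ 2 / (f b).im) ^ 2 := by
      field_simp
      ring
    rw [e] at h
    have : 0 < (f b).im ^ 2 := by positivity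
    nlinarith [sq_nonneg ‖b‖]
  have hre : 0 ≤ (f b).re := by
    let := CStarAlgebra.spectralOrder A
    let := CStarAlgebra.spectralOrderedRing A
    have hb0 : 0 ≤ b := star_mul_self_nonneg a
    -- From `0 ≤ b ≤ ‖b‖`. Applying `f` puts `f b` in the disc of centre and radius `‖b‖`, which
    -- lies in the right half-plane.
    have hn : ‖algebraMap ℝ A ‖b‖ - b‖ ≤ ‖b‖ := by
      have h0 : 0 ≤ algebraMap ℝ A ‖b‖ - b := sub_nonneg.2 hs.le_algebraMap_norm_self
      rw [CStarAlgebra.norm_le_iff_le_algebraMap _ (norm_nonneg _) h0]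
      exact sub_le_self _ hb0
    have h2 := (hle _).trans hn
    have h3 : f (algebraMap ℝ A ‖b‖ - b) = ‖b‖ - f b := by
      have : (algebraMap ℝ A ‖b‖) = (‖b‖ : ℂ) • (1 : A) := by
        rw [Algebra.algebraMap_eq_smul_one, Complex.coe_smul]
      rw [map_sub, this, map_smul, h1, smul_eq_mul, mul_one]
    rw [h3] at h2
    have h4 := (Complex.re_le_norm _).trans h2
    simp at h4
    exact h4
  exact Complex.le_def.2 ⟨hre, him.symm⟩

/-- In the commutative C*-algebra generated by `a`, some character attains the spectral radius,
which is the norm. A norm-preserving Hahn–Banach extension of it is contractive and unital, hence a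
state. -/
theorem exists_state_norm_eq [Nontrivial A] {a : A} (ha : IsSelfAdjoint a) :
    ∃ φ : State A, ‖φ.1 a‖ = ‖a‖ := by
  have := ha.isStarNormal
  let S := StarAlgebra.elemental ℂ a
  let x : S := ⟨a, StarAlgebra.elemental.self_mem ℂ a⟩
  have hx : IsSelfAdjoint x := Subtype.ext ha
  obtain ⟨z, hz, hzn⟩ := spectrum.exists_nnnorm_eq_spectralRadius x
  obtain ⟨χ, hχ⟩ := WeakDual.CharacterSpace.mem_spectrum_iff_exists.1 hz
  have hχn : ‖WeakDual.toStrongDual (χ : WeakDual ℂ S)‖ ≤ 1 :=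
    (WeakDual.CharacterSpace.norm_le_norm_one χ).trans norm_one.le
  obtain ⟨g, hg, hgn⟩ := exists_extension_norm_eq (Subalgebra.toSubmodule S.toSubalgebra)
    (WeakDual.toStrongDual (χ : WeakDual ℂ S))
  have hg1 : g 1 = 1 := (hg ⟨1, one_mem S⟩).trans (map_one χ)
  refine ⟨⟨StrongDual.toWeakDual g, fun b => nonneg_of_norm_le_one (hgn.le.trans hχn) hg1 b, hg1⟩,
    ?_⟩
  have h1 : g a = z := (hg x).trans hχ
  have h2 : ‖z‖₊ = ‖x‖₊ := by
    rw [hx.spectralRadius_eq_nnnorm] at hzn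
    exact_mod_cast hzn
  change ‖g a‖ = ‖a‖
  rw [h1]
  exact congrArg NNReal.toReal h2

theorem norm_le_of_forall_state [Nontrivial A] {a : A} (ha : IsSelfAdjoint a) {r : ℝ}
    (h : ∀ φ : State A, ‖φ.1 a‖ ≤ r) : ‖a‖ ≤ r := by
  obtain ⟨φ, hφ⟩ := exists_state_norm_eq ha
  exact hφ ▸ h φ

end States

/-! ### Compactness properties of L-seminorms -/

section Seminorm

variable {F : ℝ≥0∞ → ℝ≥0∞ → ℝ≥0∞ → ℝ≥0∞ → ℝ≥0∞}
  {A : Type*} [CStarAlgebra A] {L : selfAdjoint A → ℝ≥0∞}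

theorem IsLSeminorm.map_neg (hL : IsLSeminorm F L) (a : selfAdjoint A) : L (-a) = L a := by
  rw [← neg_one_smul ℝ a, hL.smul_eq, enorm_neg, enorm_one, one_mul]

theorem IsLSeminorm.sub_le (hL : IsLSeminorm F L) (a b : selfAdjoint A) :
    L (a - b) ≤ L a + L b := by
  rw [sub_eq_add_neg]
  exact (hL.add_le _ _).trans_eq (by rw [hL.map_neg])

theorem IsLSeminorm.map_algebraMap (hL : IsLSeminorm F L) (a : selfAdjoint A) (t : ℝ)
    (h : (a : A) = algebraMap ℂ A t) : L a = 0 :=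
  (hL.eq_zero_iff a).2 ⟨t, h⟩

theorem IsLSeminorm.map_zero (hL : IsLSeminorm F L) : L 0 = 0 :=
  hL.map_algebraMap 0 0 (by simp)

/-- Homogeneity reduces to seminorm at most one. Since `l` may vanish, rescaling is done by `k > l`;
letting `k` decrease to `l` uses that the distance is finite. -/
theorem IsLSeminorm.enorm_state_sub_le (hL : IsLSeminorm F L) {a : selfAdjoint A} {l : ℝ≥0}
    (ha : L a ≤ l) (φ ψ : State A) :
    ‖φ.1 (a : A) - ψ.1 (a : A)‖ₑ ≤ l * mkDist L φ ψ := by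
  have key : ∀ k : ℝ≥0, l < k → ‖φ.1 (a : A) - ψ.1 (a : A)‖ₑ ≤ k * mkDist L φ ψ := by
    intro k hk
    have hk0 : k ≠ 0 := (pos_of_gt hk).ne'
    have hke : ‖(k : ℝ)‖ₑ = k := by
      rw [enorm_eq_nnnorm]; simp
    set b : selfAdjoint A := ((k : ℝ)⁻¹) • a with hb
    have hab : a = (k : ℝ) • b := by
      rw [hb, smul_inv_smul₀]; exact_mod_cast hk0
    have hb1 : L b ≤ 1 := by
      have h : (k : ℝ≥0∞) * L b ≤ k * 1 := by
        rw [← hke, ← hL.smul_eq, ← hab, hke, mul_one]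
        exact ha.trans (by exact_mod_cast hk.le)
      exact (ENNReal.mul_le_mul_iff_right (by exact_mod_cast hk0) ENNReal.coe_ne_top).1 h
    have h1 : φ.1 (a : A) - ψ.1 (a : A) = (k : ℂ) * (φ.1 (b : A) - ψ.1 (b : A)) := by
      have : (a : A) = (k : ℂ) • (b : A) := by
        conv_lhs => rw [hab]
        rw [selfAdjoint.val_smul, ← Complex.coe_smul]
      rw [this, map_smul, map_smul, smul_eq_mul, smul_eq_mul, mul_sub]
    have h2 : ‖(k : ℂ)‖ₑ = k := by
      rw [enorm_eq_nnnorm]; simp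
    rw [h1, enorm_mul, h2]
    gcongr
    exact le_iSup₂ (f := fun (a : selfAdjoint A) (_ : L a ≤ 1) =>
            ‖φ.1 (a : A) - ψ.1 (a : A)‖ₑ) b hb1
  have ht : Tendsto (fun k : ℝ≥0 => (k : ℝ≥0∞) * mkDist L φ ψ) (𝓝[>] l)
      (𝓝 (l * mkDist L φ ψ)) := by
    refine (ENNReal.Tendsto.mul_const ?_ (Or.inr (hL.mkDist_ne_top φ ψ))).mono_left
      nhdsWithin_le_nhds
    exact ENNReal.tendsto_coe.2 tendsto_id
  exact ge_of_tendsto ht (eventually_mem_nhdsWithin.mono fun k hk => key k hk)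

/-- Total boundedness: Monge–Kantorovich balls are weak* open and the state space is weak* compact.
-/
theorem IsLSeminorm.exists_finset_mkDist_lt (hL : IsLSeminorm F L) {δ : ℝ≥0∞} (hδ : 0 < δ) :
    ∃ t : Finset (State A), ∀ φ : State A, ∃ ψ ∈ t, mkDist L φ ψ < δ := by
  have hopen : ∀ ψ : State A, IsOpen {φ : State A | mkDist L φ ψ < δ} := by
    intro ψ
    have h := @Metric.isOpen_eball (State A) (mkPseudoEMetric L) ψ δ
    rw [hL.metrizes_weakStar] at h
    exact h
  obtain ⟨t, -, ht⟩ := (isCompact_univ (X := State A)).elim_nhds_subcover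
    (fun ψ => {φ : State A | mkDist L φ ψ < δ}) fun ψ _ => (hopen ψ).mem_nhds (by
      change mkDist L ψ ψ < δ
      have : mkDist L ψ ψ = 0 := (mkPseudoEMetric L).edist_self ψ
      rwa [this])
  refine ⟨t, fun φ => ?_⟩
  obtain ⟨ψ, hψ, h⟩ := Set.mem_iUnion₂.1 (ht (Set.mem_univ φ))
  exact ⟨ψ, hψ, h⟩

theorem mkDist_triangle (φ ψ χ : State A) : mkDist L φ χ ≤ mkDist L φ ψ + mkDist L ψ χ :=
  (mkPseudoEMetric L).edist_triangle φ ψ χ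

/-- The sum over a finite 1-net is a crude substitute for the maximal distance from the net to `φ₀`.
-/
theorem IsLSeminorm.exists_mkDist_le (hL : IsLSeminorm F L) (φ₀ : State A) :
    ∃ M : ℝ≥0, ∀ φ : State A, mkDist L φ φ₀ ≤ M := by
  obtain ⟨t, ht⟩ := hL.exists_finset_mkDist_lt (δ := 1) zero_lt_one
  refine ⟨(1 + ∑ ψ ∈ t, mkDist L ψ φ₀).toNNReal, fun φ => ?_⟩
  have hne : 1 + ∑ ψ ∈ t, mkDist L ψ φ₀ ≠ ∞ :=
    ENNReal.add_ne_top.2 ⟨ENNReal.one_ne_top, ENNReal.sum_ne_top.2 fun ψ _ => hL.mkDist_ne_top _ _⟩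
  rw [ENNReal.coe_toNNReal hne]
  obtain ⟨ψ, hψ, h⟩ := ht φ
  exact (mkDist_triangle φ ψ φ₀).trans (add_le_add h.le
    (Finset.single_le_sum (f := fun ψ => mkDist L ψ φ₀) (fun _ _ => zero_le) hψ))

/-- Modulo scalars, the elements of seminorm at most `l` form a bounded set. -/
theorem IsLSeminorm.exists_norm_sub_algebraMap_le [Nontrivial A] (hL : IsLSeminorm F L) :
    ∃ M : ℝ, ∀ (a : selfAdjoint A) (l : ℝ≥0), L a ≤ l →
      ∃ t : ℝ, ‖(a : A) - algebraMap ℂ A t‖ ≤ l * M := by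
  obtain ⟨φ₀, -⟩ := exists_state_norm_eq (IsSelfAdjoint.one A)
  obtain ⟨M, hM⟩ := hL.exists_mkDist_le φ₀
  refine ⟨M, fun a l hl => ⟨(φ₀.1 (a : A)).re, ?_⟩⟩
  have hsa : IsSelfAdjoint ((a : A) - algebraMap ℂ A ((φ₀.1 (a : A)).re : ℂ)) :=
    a.2.sub ((IsSelfAdjoint.algebraMap A (Complex.conj_ofReal _)))
  refine norm_le_of_forall_state hsa fun φ => ?_
  rw [map_sub, φ.map_complex, ← φ₀.map_selfAdjoint a.2]
  have h := (hL.enorm_state_sub_le hl φ φ₀).trans (mul_le_mul_right (hM φ) _)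
  rw [enorm_eq_nnnorm] at h
  exact_mod_cast h

/-- Sets of bounded norm and seminorm are relatively compact. -/
theorem IsLSeminorm.exists_tendsto [Nontrivial A] (hL : IsLSeminorm F L) {ι : Type*}
    (U : Ultrafilter ι) (b : ι → selfAdjoint A) {l : ℝ≥0} {r : ℝ} (hl : ∀ᶠ i in U, L (b i) ≤ l)
    (hr : ∀ᶠ i in U, ‖b i‖ ≤ r) :
    ∃ a : selfAdjoint A, Tendsto b U (𝓝 a) := by
  have hcau : Cauchy (map b (U : Filter ι)) := by
    rw [Metric.cauchy_iff]
    refine ⟨inferInstance, fun ε hε => ?_⟩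
    obtain ⟨δ, hδ, hδε⟩ : ∃ δ : ℝ≥0, 0 < δ ∧ (4 + 2 * l) * (δ : ℝ) < ε := by
      have h0 : (0 : ℝ) < 4 + 2 * l := by positivity
      have h1 : 0 < ε / (2 * (4 + 2 * l)) := by positivity
      refine ⟨(ε / (2 * (4 + 2 * l))).toNNReal, Real.toNNReal_pos.2 h1, ?_⟩
      rw [Real.coe_toNNReal _ h1.le]
      field_simp
      norm_num
    -- Arzelà–Ascoli: the elements, seen as functions on states, are equi-Lipschitz, so convergence
    -- along `U` at a finite net of states makes them uniformly Cauchy. Two changes of state cost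
    -- `lδ` each and two limits cost `δ` each, within `(4 + 2l)δ`.
    obtain ⟨t, ht⟩ := hL.exists_finset_mkDist_lt (δ := δ) (by exact_mod_cast hδ)
    have hlim : ∀ ψ : State A, ∃ z : ℂ, ∀ᶠ i in U, ‖ψ.1 (b i : A) - z‖ < δ := by
      intro ψ
      obtain ⟨z, -, hz⟩ := (isCompact_closedBall (0 : ℂ) r).ultrafilter_le_nhds
        (U.map fun i => ψ.1 (b i : A)) (by
          rw [le_principal_iff]
          change ∀ᶠ i in U, ψ.1 (b i : A) ∈ Metric.closedBall 0 r
          filter_upwards [hr] with i hi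
          rw [mem_closedBall_zero_iff]
          exact (ψ.norm_apply_le _).trans hi)
      refine ⟨z, ?_⟩
      have := hz (Metric.ball_mem_nhds z (ε := δ) (by exact_mod_cast hδ))
      filter_upwards [this] with i hi
      rwa [Set.mem_preimage, mem_ball_iff_norm] at hi
    choose z hz using hlim
    have hz' : ∀ᶠ i in U, ∀ ψ ∈ t, ‖ψ.1 (b i : A) - z ψ‖ < δ :=
      (eventually_all_finset t).2 fun ψ _ => hz ψ
    refine ⟨b '' {i | (∀ ψ ∈ t, ‖ψ.1 (b i : A) - z ψ‖ < δ) ∧ L (b i) ≤ l},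
      image_mem_map (hz'.and hl), ?_⟩
    rintro _ ⟨i, ⟨hi, hli⟩, rfl⟩ _ ⟨j, ⟨hj, hlj⟩, rfl⟩
    refine lt_of_le_of_lt ?_ hδε
    rw [dist_eq_norm]
    refine norm_le_of_forall_state (b i - b j).2 fun φ => ?_
    obtain ⟨ψ, hψ, hd⟩ := ht φ
    have h1 : ∀ k, L (b k) ≤ l → ‖φ.1 (b k : A) - ψ.1 (b k : A)‖ ≤ l * δ := by
      intro k hk
      have h := (hL.enorm_state_sub_le hk φ ψ).trans (mul_le_mul_right hd.le _)
      rw [enorm_eq_nnnorm] at h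
      exact_mod_cast h
    have h2 : φ.1 ((b i - b j : selfAdjoint A) : A) = (φ.1 (b i : A) - ψ.1 (b i : A))
        + (ψ.1 (b i : A) - z ψ) - (ψ.1 (b j : A) - z ψ) - (φ.1 (b j : A) - ψ.1 (b j : A)) := by
      rw [AddSubgroupClass.coe_sub, map_sub]; ring
    rw [h2]
    have n1 := norm_sub_le ((φ.1 (b i : A) - ψ.1 (b i : A))
        + (ψ.1 (b i : A) - z ψ) - (ψ.1 (b j : A) - z ψ)) (φ.1 (b j : A) - ψ.1 (b j : A))
    have n2 := norm_sub_le ((φ.1 (b i : A) - ψ.1 (b i : A))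
        + (ψ.1 (b i : A) - z ψ)) (ψ.1 (b j : A) - z ψ)
    have n3 := norm_add_le (φ.1 (b i : A) - ψ.1 (b i : A)) (ψ.1 (b i : A) - z ψ)
    have := h1 i hli
    have := h1 j hlj
    have := (hi ψ hψ).le
    have := (hj ψ hψ).le
    have : (0 : ℝ) ≤ δ := δ.2
    linarith
  have : CompleteSpace (selfAdjoint A) :=
    (isClosed_eq continuous_star continuous_id).completeSpace_coe
  exact CompleteSpace.complete hcau

theorem IsLSeminorm.le_of_tendsto (hL : IsLSeminorm F L) {ι : Type*} {U : Filter ι} [U.NeBot]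
    {b : ι → selfAdjoint A} {a : selfAdjoint A} (hb : Tendsto b U (𝓝 a)) {r : ℝ≥0∞}
    (h : ∀ᶠ i in U, L (b i) ≤ r) : L a ≤ r := by
  refine le_of_forall_lt fun c hc => ?_
  obtain ⟨i, h1, h2⟩ := ((hb.eventually (hL.lowerSemicontinuous a c hc)).and h).exists
  exact h1.trans_le h2

end Seminorm

/-! ### Norm comparison from a small Hausdorff distance -/

section Extent

variable {F : ℝ≥0∞ → ℝ≥0∞ → ℝ≥0∞ → ℝ≥0∞ → ℝ≥0∞}

/-- Each state of `A` is within `c` of a state factoring through `π`, and this replacement changes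
the value at `a` by at most `l * c`. This is how the extent enters all later estimates. -/
theorem IsLSeminorm.norm_le_of_hausdorffEDist_lt {A B : Type*} [CStarAlgebra A] [CStarAlgebra B]
    [Nontrivial A] {L : selfAdjoint A → ℝ≥0∞} (hL : IsLSeminorm F L) (π : A →⋆ₐ[ℂ] B) {c : ℝ≥0}
    (h : @Metric.hausdorffEDist (State A) (mkPseudoEMetric L) Set.univ (pulledBackStates π) < c)
    {a : selfAdjoint A} {l : ℝ≥0} (ha : L a ≤ l) : ‖(a : A)‖ ≤ ‖π (a : A)‖ + l * c := by
  refine norm_le_of_forall_state a.2 fun φ => ?_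
  obtain ⟨φ', ⟨ψ, hψ⟩, hd⟩ := @Metric.exists_edist_lt_of_hausdorffEDist_lt (State A)
    (mkPseudoEMetric L) φ Set.univ (pulledBackStates π) c (Set.mem_univ φ) h
  have h1 : ‖φ.1 (a : A) - φ'.1 (a : A)‖ ≤ l * c := by
    have h := (hL.enorm_state_sub_le ha φ φ').trans (mul_le_mul_right hd.le _)
    rw [enorm_eq_nnnorm] at h
    exact_mod_cast h
  have h2 : ‖φ'.1 (a : A)‖ ≤ ‖π (a : A)‖ := by
    rw [hψ]
    exact ψ.norm_apply_le _
  have h3 := norm_add_le (φ.1 (a : A) - φ'.1 (a : A)) (φ'.1 (a : A))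
  rw [sub_add_cancel] at h3
  linarith

end Extent

/-! ### Extending seminorms and lifts from self-adjoint elements to the whole algebra -/

section Complexification

variable {F : ℝ≥0∞ → ℝ≥0∞ → ℝ≥0∞ → ℝ≥0∞ → ℝ≥0∞}
  {A B : Type*} [CStarAlgebra A] [CStarAlgebra B] {L : selfAdjoint A → ℝ≥0∞}
  {LB : selfAdjoint B → ℝ≥0∞}

/-- The extension of `L` to all of `A`, by the larger of the values at the real and imaginary
parts. -/
noncomputable def complexify (L : selfAdjoint A → ℝ≥0∞) (a : A) : ℝ≥0∞ := max (L (ℜ a)) (L (ℑ a))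

theorem complexify_coe (hL : IsLSeminorm F L) (a : selfAdjoint A) :
    complexify L (a : A) = L a := by
  have h1 : ℜ (a : A) = a := Subtype.ext a.2.coe_realPart
  have h2 : ℑ (a : A) = 0 := IsSelfAdjoint.imaginaryPart a.2
  rw [complexify, h1, h2, hL.map_zero, max_eq_left zero_le]

theorem complexify_add_le (hL : IsLSeminorm F L) (a b : A) :
    complexify L (a + b) ≤ complexify L a + complexify L b := by
  rw [complexify, map_add, map_add]
  exact max_le ((hL.add_le _ _).trans (add_le_add (le_max_left _ _) (le_max_left _ _)))
    ((hL.add_le _ _).trans (add_le_add (le_max_right _ _) (le_max_right _ _)))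

theorem complexify_star (hL : IsLSeminorm F L) (a : A) :
    complexify L (star a) = complexify L a := by
  have h1 : ℜ (star a) = ℜ a := by
    ext; simp [realPart_apply_coe, add_comm]
  have h2 : ℑ (star a) = -ℑ a := by
    ext
    simp only [imaginaryPart_apply_coe, star_star, NegMemClass.coe_neg]
    rw [← smul_neg, ← smul_neg, neg_sub]
  rw [complexify, h1, h2, hL.map_neg, complexify]

/-- The factor 2 arises because a complex scalar mixes the real and imaginary parts. Only uniform
boundedness matters later, so the loss is harmless. -/
theorem complexify_smul_le (hL : IsLSeminorm F L) (z : ℂ) (a : A) :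
    complexify L (z • a) ≤ 2 * ‖z‖ₑ * complexify L a := by
  have hre : ‖z.re‖ₑ ≤ ‖z‖ₑ := by
    rw [enorm_le_iff_norm_le]; exact Complex.abs_re_le_norm z
  have him : ‖z.im‖ₑ ≤ ‖z‖ₑ := by
    rw [enorm_le_iff_norm_le]; exact Complex.abs_im_le_norm z
  have e1 : ∀ (s t : ℝ) (b c : selfAdjoint A), ‖s‖ₑ ≤ ‖z‖ₑ → ‖t‖ₑ ≤ ‖z‖ₑ →
      L b ≤ complexify L a → L c ≤ complexify L a →
      L (s • b + t • c) ≤ 2 * ‖z‖ₑ * complexify L a := by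
    intro s t b c hs ht hb hc
    refine (hL.add_le _ _).trans ?_
    rw [hL.smul_eq, hL.smul_eq, mul_assoc, two_mul]
    gcongr
  rw [complexify, realPart_smul, imaginaryPart_smul, sub_eq_add_neg, ← neg_smul]
  refine max_le (e1 _ _ _ _ hre ?_ (le_max_left _ _) (le_max_right _ _))
    (e1 _ _ _ _ hre him (le_max_right _ _) (le_max_left _ _))
  rwa [enorm_neg]

theorem complexify_neg (hL : IsLSeminorm F L) (a : A) : complexify L (-a) = complexify L a := by
  rw [complexify, _root_.map_neg, _root_.map_neg, hL.map_neg, hL.map_neg, complexify]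

theorem complexify_sub_le (hL : IsLSeminorm F L) (a b : A) :
    complexify L (a - b) ≤ complexify L a + complexify L b := by
  rw [sub_eq_add_neg]
  exact (complexify_add_le hL _ _).trans_eq (by rw [complexify_neg hL])

theorem complexify_algebraMap (hL : IsLSeminorm F L) (z : ℂ) :
    complexify L (algebraMap ℂ A z) = 0 := by
  have h1 : complexify L (1 : A) = 0 := by
    have h := complexify_coe hL (1 : selfAdjoint A)
    rw [selfAdjoint.val_one] at h
    rw [h]
    exact hL.map_algebraMap 1 1 (by simp)
  rw [Algebra.algebraMap_eq_smul_one, ← nonpos_iff_eq_zero]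
  exact (complexify_smul_le hL z 1).trans_eq (by rw [h1, mul_zero])

theorem mul_eq_realPart_imaginaryPart (a b : A) :
    a * b = (ℜ a : A) * (ℜ b : A) - (ℑ a : A) * (ℑ b : A)
      + Complex.I • ((ℜ a : A) * (ℑ b : A)) + Complex.I • ((ℑ a : A) * (ℜ b : A)) := by
  conv_lhs => rw [← realPart_add_I_smul_imaginaryPart a, ← realPart_add_I_smul_imaginaryPart b]
  simp only [add_mul, mul_add, smul_mul_assoc, mul_smul_comm, smul_add, smul_smul,
    Complex.I_mul_I]
  module

theorem realPart_mul_eq (a b : A) : ℜ (a * b) =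
    jordan (ℜ a) (ℜ b) - jordan (ℑ a) (ℑ b) - lie (ℜ a) (ℑ b) - lie (ℑ a) (ℜ b) := by
  rw [mul_eq_realPart_imaginaryPart]
  simp only [map_add, map_sub, realPart_I_smul, jordan, lie]
  abel

theorem imaginaryPart_mul_eq (a b : A) : ℑ (a * b) =
    lie (ℜ a) (ℜ b) - lie (ℑ a) (ℑ b) + jordan (ℜ a) (ℑ b) + jordan (ℑ a) (ℜ b) := by
  rw [mul_eq_realPart_imaginaryPart]
  simp only [map_add, map_sub, imaginaryPart_I_smul, jordan, lie]

/-- The real and imaginary parts of a product are each a combination of four Jordan or Lie products,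
each controlled by the quasi-Leibniz inequality. -/
theorem complexify_mul_le (hF : IsAdmissible F) (hL : IsLSeminorm F L) {a b : A} {r l : ℝ≥0}
    (ha : ‖a‖₊ ≤ r) (hb : ‖b‖₊ ≤ r) (hla : complexify L a ≤ l) (hlb : complexify L b ≤ l) :
    complexify L (a * b) ≤ 4 * F r r l l := by
  have hjl : ∀ c d : selfAdjoint A, ‖(c : A)‖₊ ≤ r → ‖(d : A)‖₊ ≤ r → L c ≤ l → L d ≤ l →
      L (jordan c d) ≤ F r r l l ∧ L (lie c d) ≤ F r r l l := by
    intro c d hc hd hlc hld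
    have h := (hL.quasiLeibniz c d (ne_top_of_le_ne_top ENNReal.coe_ne_top hlc)
      (ne_top_of_le_ne_top ENNReal.coe_ne_top hld)).trans
      (hF.mono (ENNReal.coe_le_coe.2 hc) (ENNReal.coe_le_coe.2 hd) hlc hld)
    exact max_le_iff.1 h
  have ra : ‖(ℜ a : A)‖₊ ≤ r := le_trans (realPart.norm_le a :) ha
  have ia : ‖(ℑ a : A)‖₊ ≤ r := le_trans (imaginaryPart.norm_le a :) ha
  have rb : ‖(ℜ b : A)‖₊ ≤ r := le_trans (realPart.norm_le b :) hb
  have ib : ‖(ℑ b : A)‖₊ ≤ r := le_trans (imaginaryPart.norm_le b :) hb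
  obtain ⟨lra, lia⟩ := max_le_iff.1 hla
  obtain ⟨lrb, lib⟩ := max_le_iff.1 hlb
  obtain ⟨j1, l1⟩ := hjl _ _ ra rb lra lrb
  obtain ⟨j2, l2⟩ := hjl _ _ ia ib lia lib
  obtain ⟨j3, l3⟩ := hjl _ _ ra ib lra lib
  obtain ⟨j4, l4⟩ := hjl _ _ ia rb lia lrb
  have e4 : 4 * F r r l l = F r r l l + F r r l l + F r r l l + F r r l l := by ring
  rw [e4, complexify, realPart_mul_eq, imaginaryPart_mul_eq]
  refine max_le ?_ ?_
  · refine (hL.sub_le _ _).trans (add_le_add ((hL.sub_le _ _).trans (add_le_add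
      ((hL.sub_le _ _).trans (add_le_add j1 j2)) l3)) l4)
  · refine (hL.add_le _ _).trans (add_le_add ((hL.add_le _ _).trans (add_le_add
      ((hL.sub_le _ _).trans (add_le_add l1 l2)) j3)) j4)

theorem exists_complexify_ne_top (hL : IsLSeminorm F L) (a : A) {ε : ℝ} (hε : 0 < ε) :
    ∃ b : A, complexify L b ≠ ∞ ∧ ‖b - a‖ ≤ ε := by
  obtain ⟨b, hb, hbd⟩ := hL.dense_dom.exists_dist_lt (ℜ a) (half_pos hε)
  obtain ⟨c, hc, hcd⟩ := hL.dense_dom.exists_dist_lt (ℑ a) (half_pos hε)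
  refine ⟨b + Complex.I • (c : A), ne_top_of_le_ne_top ?_ (complexify_add_le hL _ _), ?_⟩
  · refine ENNReal.add_ne_top.2 ⟨by rwa [complexify_coe hL], ne_top_of_le_ne_top ?_
      (complexify_smul_le hL _ _)⟩
    rw [complexify_coe hL]
    exact ENNReal.mul_ne_top (ENNReal.mul_ne_top (by simp) enorm_ne_top) hc
  · have h1 : ‖(b : A) - (ℜ a : A)‖ < ε / 2 := by rw [dist_comm, dist_eq_norm] at hbd; exact hbd
    have h2 : ‖(c : A) - (ℑ a : A)‖ < ε / 2 := by rw [dist_comm, dist_eq_norm] at hcd; exact hcd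
    have e : (b : A) + Complex.I • (c : A) - a
        = ((b : A) - (ℜ a : A)) + Complex.I • ((c : A) - (ℑ a : A)) := by
      conv_lhs => rw [← realPart_add_I_smul_imaginaryPart a]
      module
    rw [e]
    refine (norm_add_le _ _).trans ?_
    rw [norm_smul, Complex.norm_I, one_mul]
    linarith

theorem realPart_map (π : A →⋆ₐ[ℂ] B) (a : A) : ℜ (π a) = saMap π (ℜ a) := by
  ext
  simp only [realPart_apply_coe, saMap]
  rw [← Complex.coe_smul, ← Complex.coe_smul, map_smul, map_add, map_star]

theorem imaginaryPart_map (π : A →⋆ₐ[ℂ] B) (a : A) : ℑ (π a) = saMap π (ℑ a) := by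
  ext
  simp only [imaginaryPart_apply_coe, saMap]
  rw [← Complex.coe_smul, ← Complex.coe_smul, map_smul, map_smul, map_sub, map_star]

theorem IsQuantumIsometry.map_le {π : A →⋆ₐ[ℂ] B} (h : IsQuantumIsometry L LB π)
    (a : selfAdjoint A) : LB (saMap π a) ≤ L a := by
  rw [h.quotient_eq]
  exact iInf₂_le (f := fun (c : selfAdjoint A) (_ : saMap π c = saMap π a) => L c) a rfl

theorem IsQuantumIsometry.exists_lift {π : A →⋆ₐ[ℂ] B} (h : IsQuantumIsometry L LB π)
    {b : selfAdjoint B} {l : ℝ≥0∞} (hb : LB b < l) :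
    ∃ a : selfAdjoint A, saMap π a = b ∧ L a < l := by
  rw [h.quotient_eq, iInf_lt_iff] at hb
  obtain ⟨a, ha⟩ := hb
  obtain ⟨hab, hl⟩ := iInf_lt_iff.1 ha
  exact ⟨a, hab, hl⟩

/-- Real and imaginary parts are lifted separately. -/
theorem IsQuantumIsometry.exists_complexify_lift {π : A →⋆ₐ[ℂ] B} (h : IsQuantumIsometry L LB π)
    {b : B} {l : ℝ≥0∞} (hb : complexify LB b < l) :
    ∃ a : A, π a = b ∧ complexify L a < l := by
  obtain ⟨c, hc, hlc⟩ := h.exists_lift (max_lt_iff.1 hb).1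
  obtain ⟨d, hd, hld⟩ := h.exists_lift (max_lt_iff.1 hb).2
  have e1 : ℜ ((c : A) + Complex.I • (d : A)) = c := by
    rw [map_add, realPart_I_smul, IsSelfAdjoint.imaginaryPart d.2, neg_zero, add_zero]
    exact Subtype.ext c.2.coe_realPart
  have e2 : ℑ ((c : A) + Complex.I • (d : A)) = d := by
    rw [map_add, imaginaryPart_I_smul, IsSelfAdjoint.imaginaryPart c.2, zero_add]
    exact Subtype.ext d.2.coe_realPart
  refine ⟨c + Complex.I • (d : A), ?_, ?_⟩
  · rw [← realPart_add_I_smul_imaginaryPart (π _), realPart_map, imaginaryPart_map, e1, e2, hc, hd]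
    exact realPart_add_I_smul_imaginaryPart b
  · rw [complexify, e1, e2]
    exact max_lt hlc hld

theorem norm_le_realPart_add_imaginaryPart (a : A) : ‖a‖ ≤ ‖(ℜ a : A)‖ + ‖(ℑ a : A)‖ := by
  conv_lhs => rw [← realPart_add_I_smul_imaginaryPart a]
  refine (norm_add_le _ _).trans ?_
  rw [norm_smul, Complex.norm_I, one_mul]

theorem IsLSeminorm.norm_le_of_complexify_le [Nontrivial A] (hL : IsLSeminorm F L)
    (π : A →⋆ₐ[ℂ] B) {c : ℝ≥0}
    (h : @Metric.hausdorffEDist (State A) (mkPseudoEMetric L) Set.univ (pulledBackStates π) < c)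
    {a : A} {l : ℝ≥0} (ha : complexify L a ≤ l) : ‖a‖ ≤ 2 * ‖π a‖ + 2 * l * c := by
  have h1 := hL.norm_le_of_hausdorffEDist_lt π h (max_le_iff.1 ha).1
  have h2 := hL.norm_le_of_hausdorffEDist_lt π h (max_le_iff.1 ha).2
  have h3 : ‖π (ℜ a : A)‖ ≤ ‖π a‖ := by
    have : ((ℜ (π a) : selfAdjoint B) : B) = π (ℜ a : A) :=
      congrArg Subtype.val (realPart_map π a)
    rw [← this]
    exact (realPart.norm_le (π a) :)
  have h4 : ‖π (ℑ a : A)‖ ≤ ‖π a‖ := by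
    have : ((ℑ (π a) : selfAdjoint B) : B) = π (ℑ a : A) :=
      congrArg Subtype.val (imaginaryPart_map π a)
    rw [← this]
    exact (imaginaryPart.norm_le (π a) :)
  have := norm_le_realPart_add_imaginaryPart a
  linarith

end Complexification

/-! ### Convergence of sequences through tunnels, and its algebraic structure -/

section Representatives

variable {F : ℝ≥0∞ → ℝ≥0∞ → ℝ≥0∞ → ℝ≥0∞ → ℝ≥0∞}

theorem norm_map_le {A B : Type*} [CStarAlgebra A] [CStarAlgebra B] (π : A →⋆ₐ[ℂ] B) (a : A) :
    ‖π a‖ ≤ ‖a‖ :=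
  NonUnitalStarAlgHom.norm_apply_le π a

theorem Tunnel.norm_le {A B : QCMS F} (τ : Tunnel A B) {c : ℝ≥0} (hc : τ.extent < c)
    {d : selfAdjoint τ.space} {l : ℝ≥0} (hd : τ.space.L d ≤ l) :
    ‖(d : τ.space)‖ ≤ ‖τ.fst (d : τ.space)‖ + l * c ∧
      ‖(d : τ.space)‖ ≤ ‖τ.snd (d : τ.space)‖ + l * c :=
  ⟨τ.space.isLSeminorm.norm_le_of_hausdorffEDist_lt τ.fst (max_lt_iff.1 hc).1 hd,
    τ.space.isLSeminorm.norm_le_of_hausdorffEDist_lt τ.snd (max_lt_iff.1 hc).2 hd⟩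

theorem Tunnel.norm_le_complexify {A B : QCMS F} (τ : Tunnel A B) {c : ℝ≥0} (hc : τ.extent < c)
    {d : τ.space} {l : ℝ≥0} (hd : complexify τ.space.L d ≤ l) :
    ‖d‖ ≤ 2 * ‖τ.fst d‖ + 2 * l * c ∧ ‖d‖ ≤ 2 * ‖τ.snd d‖ + 2 * l * c :=
  ⟨τ.space.isLSeminorm.norm_le_of_complexify_le τ.fst (max_lt_iff.1 hc).1 hd,
    τ.space.isLSeminorm.norm_le_of_complexify_le τ.snd (max_lt_iff.1 hc).2 hd⟩

theorem complexify_map_le {A B : QCMS F} {π : A →⋆ₐ[ℂ] B} (h : IsQuantumIsometry A.L B.L π)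
    (a : A) : complexify B.L (π a) ≤ complexify A.L a := by
  rw [complexify, realPart_map, imaginaryPart_map]
  exact max_le_max (h.map_le _) (h.map_le _)

variable {As : ℕ → QCMS F} {A : QCMS F} {U : Ultrafilter ℕ} {τ : ∀ n, Tunnel (As n) A}

theorem eventually_exists_nnreal (hτ : Tendsto (fun n => (τ n).extent) U (𝓝 0)) (l : ℝ≥0)
    {δ : ℝ} (hδ : 0 < δ) :
    ∃ c : ℝ≥0, 2 * l * (c : ℝ) ≤ δ ∧ ∀ᶠ n in U, (τ n).extent < c := by
  have h : (0 : ℝ) < δ / (2 * l + 1) := by positivity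
  -- The added 1 keeps the denominator positive when `l = 0`.
  refine ⟨(δ / (2 * l + 1)).toNNReal, ?_, hτ.eventually_lt_const ?_⟩
  · rw [Real.coe_toNNReal _ h.le, mul_div_assoc', div_le_iff₀ (by positivity)]
    nlinarith
  · exact_mod_cast Real.toNNReal_pos.2 h

theorem eventually_norm_le (hτ : Tendsto (fun n => (τ n).extent) U (𝓝 0)) (l : ℝ≥0)
    {δ : ℝ} (hδ : 0 < δ) :
    ∀ᶠ n in U, ∀ d : selfAdjoint (τ n).space, (τ n).space.L d ≤ l →
      ‖(d : (τ n).space)‖ ≤ ‖(τ n).fst (d : (τ n).space)‖ + δ ∧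
        ‖(d : (τ n).space)‖ ≤ ‖(τ n).snd (d : (τ n).space)‖ + δ := by
  obtain ⟨c, hc, h⟩ := eventually_exists_nnreal hτ l hδ
  filter_upwards [h] with n hn d hd
  have h2 := (τ n).norm_le hn hd
  have : (0 : ℝ) ≤ l * c := by positivity
  exact ⟨by linarith, by linarith⟩

theorem eventually_norm_le_complexify (hτ : Tendsto (fun n => (τ n).extent) U (𝓝 0)) (l : ℝ≥0)
    {δ : ℝ} (hδ : 0 < δ) :
    ∀ᶠ n in U, ∀ d : (τ n).space, complexify (τ n).space.L d ≤ l →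
      ‖d‖ ≤ 2 * ‖(τ n).fst d‖ + δ ∧ ‖d‖ ≤ 2 * ‖(τ n).snd d‖ + δ := by
  obtain ⟨c, hc, h⟩ := eventually_exists_nnreal hτ l hδ
  filter_upwards [h] with n hn d hd
  have h2 := (τ n).norm_le_complexify hn hd
  exact ⟨by linarith, by linarith⟩

variable (U τ) in
/-- The sequence `x` represents `a` along the ultrafilter `U`: up to any error, `x n` and `a` are
the images of an element of the `n`-th tunnel, with seminorm bounded uniformly in `n`. -/
def Rep (a : A) (x : ∀ n, As n) : Prop :=
  ∀ ε : ℝ, 0 < ε → ∃ l : ℝ≥0, ∀ᶠ n in U, ∃ d : (τ n).space,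
    complexify (τ n).space.L d ≤ l ∧ ‖(τ n).snd d - a‖ ≤ ε ∧ ‖(τ n).fst d - x n‖ ≤ ε

/-- The seminorm bound in `Rep` may depend on the error, so approximants need no common bound. -/
theorem Rep.closed {a : A} {x : ∀ n, As n}
    (h : ∀ ε : ℝ, 0 < ε → ∃ a' x', Rep U τ a' x' ∧ ‖a' - a‖ ≤ ε ∧ ∀ᶠ n in U, ‖x' n - x n‖ ≤ ε) :
    Rep U τ a x := by
  intro ε hε
  obtain ⟨a', x', h', ha, hx⟩ := h (ε / 2) (half_pos hε)
  obtain ⟨l, hl⟩ := h' (ε / 2) (half_pos hε)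
  refine ⟨l, ?_⟩
  filter_upwards [hl, hx] with n ⟨d, hd, h1, h2⟩ h3
  refine ⟨d, hd, ?_, ?_⟩
  · have := norm_sub_le_norm_sub_add_norm_sub ((τ n).snd d) a' a
    linarith
  · have := norm_sub_le_norm_sub_add_norm_sub ((τ n).fst d) (x' n) (x n)
    linarith

theorem Rep.congr {a : A} {x y : ∀ n, As n} (h : Rep U τ a x)
    (hxy : ∀ ε : ℝ, 0 < ε → ∀ᶠ n in U, ‖x n - y n‖ ≤ ε) : Rep U τ a y :=
  Rep.closed fun ε hε => ⟨a, x, h, by simpa using hε.le, hxy ε hε⟩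

theorem Rep.of_tendsto {a : A} {x : ∀ n, As n} (d : ∀ n, (τ n).space) {l : ℝ≥0}
    (hl : ∀ᶠ n in U, complexify (τ n).space.L (d n) ≤ l)
    (ha : Tendsto (fun n => (τ n).snd (d n)) U (𝓝 a)) (hx : ∀ᶠ n in U, (τ n).fst (d n) = x n) :
    Rep U τ a x := by
  intro ε hε
  refine ⟨l, ?_⟩
  filter_upwards [hl, hx, ha.eventually (Metric.closedBall_mem_nhds a hε)] with n h1 h2 h3
  refine ⟨d n, h1, ?_, ?_⟩
  · rwa [← mem_closedBall_iff_norm]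
  · rw [h2, sub_self, norm_zero]; exact hε.le

theorem Rep.of_lift {a : A} {x : ∀ n, As n} {l : ℝ≥0}
    (h : ∀ᶠ n in U, ∃ d : (τ n).space, complexify (τ n).space.L d ≤ l ∧
      (τ n).snd d = a ∧ (τ n).fst d = x n) : Rep U τ a x := by
  intro ε hε
  refine ⟨l, h.mono fun n => ?_⟩
  rintro ⟨d, hd, h1, h2⟩
  refine ⟨d, hd, ?_, ?_⟩
  · rw [h1, sub_self, norm_zero]; exact hε.le
  · rw [h2, sub_self, norm_zero]; exact hε.le

theorem Rep.scalar (z : ℂ) : Rep U τ (algebraMap ℂ A z) (fun n => algebraMap ℂ (As n) z) := by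
  refine Rep.of_lift (l := 0) (Eventually.of_forall fun n =>
    ⟨algebraMap ℂ (τ n).space z, ?_, ?_, ?_⟩)
  · rw [complexify_algebraMap (τ n).space.isLSeminorm]; simp
  · exact AlgHomClass.commutes (τ n).snd z
  · exact AlgHomClass.commutes (τ n).fst z

theorem Rep.add {a b : A} {x y : ∀ n, As n} (h : Rep U τ a x) (h' : Rep U τ b y) :
    Rep U τ (a + b) (fun n => x n + y n) := by
  intro ε hε
  obtain ⟨l, hl⟩ := h (ε / 2) (half_pos hε)
  obtain ⟨l', hl'⟩ := h' (ε / 2) (half_pos hε)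
  refine ⟨l + l', ?_⟩
  filter_upwards [hl, hl'] with n ⟨d, hd, h1, h2⟩ ⟨e, he, h3, h4⟩
  refine ⟨d + e, ?_, ?_, ?_⟩
  · rw [ENNReal.coe_add]
    exact (complexify_add_le (τ n).space.isLSeminorm _ _).trans (add_le_add hd he)
  · rw [map_add, add_sub_add_comm]
    exact (norm_add_le _ _).trans (by linarith)
  · rw [map_add, add_sub_add_comm]
    exact (norm_add_le _ _).trans (by linarith)

theorem Rep.map_star {a : A} {x : ∀ n, As n} (h : Rep U τ a x) :
    Rep U τ (star a) (fun n => star (x n)) := by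
  intro ε hε
  obtain ⟨l, hl⟩ := h ε hε
  refine ⟨l, hl.mono fun n => ?_⟩
  rintro ⟨d, hd, h1, h2⟩
  refine ⟨star d, ?_, ?_, ?_⟩
  · rwa [complexify_star (τ n).space.isLSeminorm]
  · rwa [StarHomClass.map_star, ← star_sub, norm_star]
  · rwa [StarHomClass.map_star, ← star_sub, norm_star]

/-- Both norms are compared with that of a common lift. The factor 2 comes from treating real and
imaginary parts separately; it does not affect uniqueness or Cauchy arguments. -/
theorem Rep.norm_le (hτ : Tendsto (fun n => (τ n).extent) U (𝓝 0)) {a : A} {x : ∀ n, As n}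
    (h : Rep U τ a x) {δ : ℝ} (hδ : 0 < δ) :
    ∀ᶠ n in U, ‖x n‖ ≤ 2 * ‖a‖ + δ ∧ ‖a‖ ≤ 2 * ‖x n‖ + δ := by
  obtain ⟨l, hl⟩ := h (δ / 4) (by positivity)
  filter_upwards [hl, eventually_norm_le_complexify hτ l (δ := δ / 4) (by positivity)] with
    n ⟨d, hd, h1, h2⟩ h3
  obtain ⟨h4, h5⟩ := h3 d hd
  have h6 := norm_map_le (τ n).fst d
  have h7 := norm_map_le (τ n).snd d
  have h8 := abs_le.1 (abs_norm_sub_norm_le ((τ n).snd d) a)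
  have h9 := abs_le.1 (abs_norm_sub_norm_le ((τ n).fst d) (x n))
  constructor <;> linarith [h8.1, h8.2, h9.1, h9.2]

/-- Replacing the lift by its real part does not increase the errors and removes the factor 2, as
the sharp constants in the limit require. -/
theorem Rep.norm_le_of_selfAdjoint (hτ : Tendsto (fun n => (τ n).extent) U (𝓝 0)) {a : A}
    {x : ∀ n, As n} (h : Rep U τ a x) (ha : IsSelfAdjoint a) (hx : ∀ n, IsSelfAdjoint (x n))
    {δ : ℝ} (hδ : 0 < δ) :
    ∀ᶠ n in U, ‖x n‖ ≤ ‖a‖ + δ ∧ ‖a‖ ≤ ‖x n‖ + δ := by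
  obtain ⟨l, hl⟩ := h (δ / 4) (by positivity)
  filter_upwards [hl, eventually_norm_le hτ l (δ := δ / 4) (by positivity)] with
    n ⟨d, hd, h1, h2⟩ h3
  obtain ⟨h4, h5⟩ := h3 (ℜ d) (max_le_iff.1 hd).1
  have h6 := norm_map_le (τ n).fst (ℜ d : (τ n).space)
  have h7 := norm_map_le (τ n).snd (ℜ d : (τ n).space)
  have e1 : (τ n).snd (ℜ d : (τ n).space) - a = (ℜ ((τ n).snd d - a) : selfAdjoint A) := by
    rw [map_sub, realPart_map, AddSubgroupClass.coe_sub, ha.coe_realPart]; rfl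
  have e2 : (τ n).fst (ℜ d : (τ n).space) - x n
      = (ℜ ((τ n).fst d - x n) : selfAdjoint (As n)) := by
    rw [map_sub, realPart_map, AddSubgroupClass.coe_sub, (hx n).coe_realPart]; rfl
  have h1' : ‖(τ n).snd (ℜ d : (τ n).space) - a‖ ≤ δ / 4 := by
    rw [e1]; exact le_trans (realPart.norm_le ((τ n).snd d - a) :) h1
  have h2' : ‖(τ n).fst (ℜ d : (τ n).space) - x n‖ ≤ δ / 4 := by
    rw [e2]; exact le_trans (realPart.norm_le ((τ n).fst d - x n) :) h2
  have h8 := abs_le.1 (abs_norm_sub_norm_le ((τ n).snd (ℜ d : (τ n).space)) a)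
  have h9 := abs_le.1 (abs_norm_sub_norm_le ((τ n).fst (ℜ d : (τ n).space)) (x n))
  constructor <;> linarith [h8.1, h8.2, h9.1, h9.2]

/-- Products of lifts are lifts of the product. Their norms stay bounded by the norm comparison, and
then finiteness of `F` at finite arguments bounds their seminorms uniformly. -/
theorem Rep.mul (hF : IsAdmissible F) (hτ : Tendsto (fun n => (τ n).extent) U (𝓝 0))
    {a b : A} {x y : ∀ n, As n} (h : Rep U τ a x) (h' : Rep U τ b y) :
    Rep U τ (a * b) (fun n => x n * y n) := by
  intro ε hε
  -- `R` bounds the norms of both lifts and is exactly the sum of the coefficients of `δ` in the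
  -- error at the `fst` end.
  set R : ℝ := 2 * ‖a‖ + 2 * ‖b‖ + 7 with hR
  have ha0 := norm_nonneg a
  have hb0 := norm_nonneg b
  have hR0 : 0 < R := by positivity
  obtain ⟨δ, hδ, hδ1, hδR⟩ : ∃ δ : ℝ, 0 < δ ∧ δ ≤ 1 ∧ δ * R ≤ ε := by
    refine ⟨min 1 (ε / R), by positivity, min_le_left _ _, ?_⟩
    exact (mul_le_mul_of_nonneg_right (min_le_right _ _) hR0.le).trans_eq (by field_simp)
  obtain ⟨l, hl⟩ := h δ hδ
  obtain ⟨l', hl'⟩ := h' δ hδ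
  let r : ℝ≥0 := R.toNNReal
  let m : ℝ≥0 := max l l'
  have hne : 4 * F r r m m ≠ ∞ := ENNReal.mul_ne_top (by simp) (hF.finite _ _ _ _)
  refine ⟨(4 * F r r m m).toNNReal, ?_⟩
  filter_upwards [hl, hl', eventually_norm_le_complexify hτ l one_pos,
    eventually_norm_le_complexify hτ l' one_pos] with n ⟨d, hd, h1, h2⟩ ⟨e, he, h3, h4⟩ h5 h6
  have hdn := (h5 d hd).2
  have hen := (h6 e he).2
  have n1 := abs_le.1 (abs_norm_sub_norm_le ((τ n).snd d) a)
  have n2 := abs_le.1 (abs_norm_sub_norm_le ((τ n).snd e) b)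
  have n3 := abs_le.1 (abs_norm_sub_norm_le ((τ n).fst d) (x n))
  have n4 := norm_map_le (τ n).fst e
  have n5 := norm_map_le (τ n).fst d
  have hdR : ‖d‖ ≤ R := by linarith [n1.2]
  have heR : ‖e‖ ≤ R := by linarith [n2.2]
  refine ⟨d * e, ?_, ?_, ?_⟩
  · rw [ENNReal.coe_toNNReal hne]
    refine complexify_mul_le hF (τ n).space.isLSeminorm ?_ ?_
      (hd.trans (ENNReal.coe_le_coe.2 (le_max_left _ _)))
      (he.trans (ENNReal.coe_le_coe.2 (le_max_right _ _)))
    · rw [← NNReal.coe_le_coe, Real.coe_toNNReal _ hR0.le]; exact hdR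
    · rw [← NNReal.coe_le_coe, Real.coe_toNNReal _ hR0.le]; exact heR
  · have e1 : (τ n).snd (d * e) - a * b
        = ((τ n).snd d - a) * (τ n).snd e + a * ((τ n).snd e - b) := by
      rw [map_mul]; noncomm_ring
    rw [e1]
    calc _ ≤ ‖(τ n).snd d - a‖ * ‖(τ n).snd e‖ + ‖a‖ * ‖(τ n).snd e - b‖ :=
          (norm_add_le _ _).trans (add_le_add (norm_mul_le _ _) (norm_mul_le _ _))
      _ ≤ δ * (‖b‖ + 1) + ‖a‖ * δ := by
          gcongr
          linarith [n2.2]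
      _ ≤ δ * R := by rw [hR]; nlinarith
      _ ≤ ε := hδR
  · have e1 : (τ n).fst (d * e) - x n * y n
        = ((τ n).fst d - x n) * (τ n).fst e + x n * ((τ n).fst e - y n) := by
      rw [map_mul]; noncomm_ring
    rw [e1]
    calc _ ≤ ‖(τ n).fst d - x n‖ * ‖(τ n).fst e‖ + ‖x n‖ * ‖(τ n).fst e - y n‖ :=
          (norm_add_le _ _).trans (add_le_add (norm_mul_le _ _) (norm_mul_le _ _))
      _ ≤ δ * (2 * ‖b‖ + 3) + (2 * ‖a‖ + 4) * δ := by
          gcongr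
          · linarith [n2.2]
          · linarith [n1.2, n3.1]
      _ = δ * R := by rw [hR]; ring
      _ ≤ ε := hδR

theorem Rep.smul (hF : IsAdmissible F) (hτ : Tendsto (fun n => (τ n).extent) U (𝓝 0))
    (z : ℂ) {a : A} {x : ∀ n, As n} (h : Rep U τ a x) :
    Rep U τ (z • a) (fun n => z • x n) := by
  have h := (Rep.scalar (U := U) (τ := τ) z).mul hF hτ h
  simpa only [← Algebra.smul_def] using h

theorem Rep.sub (hF : IsAdmissible F) (hτ : Tendsto (fun n => (τ n).extent) U (𝓝 0))
    {a b : A} {x y : ∀ n, As n} (h : Rep U τ a x) (h' : Rep U τ b y) :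
    Rep U τ (a - b) (fun n => x n - y n) := by
  have h := h.add (h'.smul hF hτ (-1))
  simpa only [neg_one_smul, ← sub_eq_add_neg] using h

/-- The difference is represented by the zero sequence, so its norm is below every positive number.
-/
theorem Rep.unique (hF : IsAdmissible F) (hτ : Tendsto (fun n => (τ n).extent) U (𝓝 0))
    {a b : A} {x : ∀ n, As n} (h : Rep U τ a x) (h' : Rep U τ b x) : a = b := by
  have h := h.sub hF hτ h'
  rw [← sub_eq_zero, ← norm_le_zero_iff]
  refine le_of_forall_pos_le_add fun δ hδ => ?_
  obtain ⟨n, -, hn⟩ := (h.norm_le hτ hδ).exists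
  simpa using hn

theorem Rep.eventually_norm_sub_le (hF : IsAdmissible F)
    (hτ : Tendsto (fun n => (τ n).extent) U (𝓝 0)) {a : A} {x y : ∀ n, As n}
    (h : Rep U τ a x) (h' : Rep U τ a y) {ε : ℝ} (hε : 0 < ε) : ∀ᶠ n in U, ‖x n - y n‖ ≤ ε := by
  filter_upwards [(h.sub hF hτ h').norm_le hτ hε] with n hn
  simpa using hn.1

end Representatives

/-! ### Existence of representatives and of limits; induced endomorphisms -/

section Existence

variable {F : ℝ≥0∞ → ℝ≥0∞ → ℝ≥0∞ → ℝ≥0∞ → ℝ≥0∞}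
variable {As : ℕ → QCMS F} {A : QCMS F} {U : Ultrafilter ℕ} {τ : ∀ n, Tunnel (As n) A}

/-- One sequence must serve every error at once, although `a` may have infinite seminorm. Take `d n`
almost minimizing the distance from its image to `a`, penalized by `w n` times the seminorm. The
weight tends to zero, so `a` is approximated, yet exceeds the extent, so the seminorm cost in the
norm comparison is absorbed by the penalty. The lifts witnessing `Rep` are those of a Lipschitz
approximation of `a`, not `d n` itself. -/
theorem exists_rep (hU : (U : Filter ℕ) ≤ atTop)
    (hτ : Tendsto (fun n => (τ n).extent) U (𝓝 0)) (a : A) : ∃ x, Rep U τ a x := by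
  -- The second summand keeps the weight positive, so an infinite seminorm is penalized, and
  -- strictly above the extent when that is finite.
  let w : ℕ → ℝ≥0 := fun n => (τ n).extent.toNNReal + 1 / ((n : ℝ≥0) + 1)
  have hw0 : ∀ n, 0 < w n := fun n => by positivity
  have hw : Tendsto w U (𝓝 0) := by
    have h1 : Tendsto (fun n => (τ n).extent.toNNReal) U (𝓝 0) :=
      (ENNReal.tendsto_toNNReal ENNReal.zero_ne_top).comp hτ
    have h2 : Tendsto (fun n : ℕ => 1 / ((n : ℝ≥0) + 1)) U (𝓝 0) :=
      (tendsto_one_div_add_atTop_nhds_zero_nat (𝕜 := ℝ≥0)).mono_left hU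
    have h3 := h1.add h2
    rw [add_zero] at h3
    exact h3
  have hext : ∀ᶠ n in U, (τ n).extent < w n := by
    filter_upwards [hτ.eventually_lt_const ENNReal.zero_lt_top] with n hn
    rw [← ENNReal.coe_toNNReal hn.ne, ENNReal.coe_lt_coe]
    exact lt_add_of_pos_right _ (by positivity)
  let f : ∀ n, (τ n).space → ℝ≥0∞ := fun n d =>
    ‖(τ n).snd d - a‖ₑ + w n * complexify (τ n).space.L d
  have hmin : ∀ n, ∃ d, f n d < (⨅ d, f n d) + w n := by
    intro n
    refine iInf_lt_iff.1 (ENNReal.lt_add_right ?_ (by exact_mod_cast (hw0 n).ne'))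
    refine ne_top_of_le_ne_top ?_ (iInf_le (f n) 0)
    have : complexify (τ n).space.L (0 : (τ n).space) = 0 := by
      have := complexify_algebraMap (τ n).space.isLSeminorm 0
      rwa [map_zero] at this
    simp [f, this]
  choose d hd using hmin
  refine ⟨fun n => (τ n).fst (d n), fun ε hε => ?_⟩
  obtain ⟨a', ha', haa⟩ := exists_complexify_ne_top A.isLSeminorm a (ε := ε / 9) (by positivity)
  lift complexify A.L a' to ℝ≥0 using ha' with k hk
  refine ⟨k + 1, ?_⟩
  have hwl : ∀ᶠ n in U, w n * (k + 2) < (ε / 9).toNNReal := by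
    have : Tendsto (fun n => w n * (k + 2)) U (𝓝 0) := by simpa using hw.mul_const (k + 2)
    exact this.eventually_lt_const (Real.toNNReal_pos.2 (by positivity))
  filter_upwards [hext, hwl] with n hn hwn
  obtain ⟨d', hd', hld'⟩ := (τ n).snd_isometry.exists_complexify_lift (b := a')
    (l := (k + 1 : ℝ≥0)) (by rw [← hk]; exact_mod_cast lt_add_one k)
  refine ⟨d', hld'.le, ?_, ?_⟩
  · rw [hd']; linarith
  have hδ : (0 : ℝ) ≤ ε / 9 := by positivity
  have e0 : ‖a' - a‖ₑ ≤ (ε / 9).toNNReal := by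
    rw [enorm_eq_nnnorm, ENNReal.coe_le_coe, ← NNReal.coe_le_coe, Real.coe_toNNReal _ hδ]
    exact haa
  have hfd : f n (d n) ≤ 2 * (ε / 9).toNNReal := by
    calc f n (d n) ≤ f n d' + w n := (hd n).le.trans (by gcongr; exact iInf_le _ _)
      _ ≤ ((ε / 9).toNNReal + w n * (k + 1 : ℝ≥0)) + w n := by
          simp only [f]; rw [hd']; gcongr
      _ = (ε / 9).toNNReal + (w n * (k + 2) : ℝ≥0) := by push_cast; ring
      _ ≤ (ε / 9).toNNReal + (ε / 9).toNNReal := by gcongr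
      _ = _ := by ring
  have hc0 : complexify (τ n).space.L (d n) ≠ ∞ := by
    intro htop
    have : f n (d n) = ∞ := by
      simp only [f]
      rw [htop, ENNReal.mul_top (by exact_mod_cast (hw0 n).ne'), add_top]
    rw [this] at hfd
    exact absurd hfd (by simp [ENNReal.mul_eq_top])
  lift complexify (τ n).space.L (d n) to ℝ≥0 using hc0 with m hm
  have hfd' : ‖(τ n).snd (d n) - a‖ + w n * m ≤ 2 * (ε / 9) := by
    simp only [f] at hfd
    rw [← hm, enorm_eq_nnnorm] at hfd
    have h : ‖(τ n).snd (d n) - a‖₊ + w n * m ≤ 2 * (ε / 9).toNNReal := by exact_mod_cast hfd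
    rw [← NNReal.coe_le_coe] at h
    push_cast [Real.coe_toNNReal _ hδ] at h
    exact h
  have hsub : complexify (τ n).space.L (d' - d n) ≤ ((k + 1 + m : ℝ≥0) : ℝ≥0∞) := by
    refine (complexify_sub_le (τ n).space.isLSeminorm _ _).trans ?_
    rw [ENNReal.coe_add, hm]
    gcongr
  have hb := ((τ n).norm_le_complexify hn hsub).2
  have h1 := norm_map_le (τ n).fst (d' - d n)
  rw [map_sub] at h1
  rw [map_sub, hd'] at hb
  have h2 := norm_sub_le_norm_sub_add_norm_sub a' a ((τ n).snd (d n))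
  rw [norm_sub_rev a] at h2
  have h3 : (w n : ℝ) * (k + 2) < ε / 9 := by
    rw [← NNReal.coe_lt_coe, Real.coe_toNNReal _ hδ] at hwn
    exact_mod_cast hwn
  push_cast at hb
  have h4 : (0 : ℝ) < w n := by exact_mod_cast hw0 n
  have h5 : (0 : ℝ) ≤ w n * m := by positivity
  -- Norm comparison for `d' - d n` totals at most `8ε/9`: `2ε/9` from `a' - a`, `4ε/9` from the
  -- almost minimal value, and `2ε/9` from `w n * (k + 1)`.
  nlinarith [norm_nonneg ((τ n).snd (d n) - a)]

/-- Lift `x n` to the tunnel and push the lift to `A`. The images are bounded in norm and seminorm,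
hence converge along `U`, and lower semicontinuity keeps the bound `l`. -/
theorem exists_rep_of_lift_le {x : ∀ n, selfAdjoint (As n)} {l : ℝ≥0} {r : ℝ}
    (hτ : Tendsto (fun n => (τ n).extent) U (𝓝 0))
    (hl : ∀ᶠ n in U, (As n).L (x n) < l) (hr : ∀ᶠ n in U, ‖(x n : As n)‖ ≤ r) :
    ∃ a : selfAdjoint A, A.L a ≤ l ∧ Rep U τ (a : A) (fun n => (x n : As n)) := by
  have h : ∀ᶠ n in U, ∃ d : selfAdjoint (τ n).space,
      saMap (τ n).fst d = x n ∧ (τ n).space.L d ≤ l := by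
    filter_upwards [hl] with n hn
    obtain ⟨d, hd, hdl⟩ := (τ n).fst_isometry.exists_lift hn
    exact ⟨d, hd, hdl.le⟩
  obtain ⟨d, hd⟩ := skolem.1 h
  have hlb : ∀ᶠ n in U, A.L (saMap (τ n).snd (d n)) ≤ l := by
    filter_upwards [hd] with n hn
    exact ((τ n).snd_isometry.map_le _).trans hn.2
  have hrb : ∀ᶠ n in U, ‖saMap (τ n).snd (d n)‖ ≤ r + 1 := by
    filter_upwards [hd, hr, eventually_norm_le hτ l one_pos] with n ⟨h1, h2⟩ h3 h4
    have h5 := (h4 _ h2).1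
    have h6 : (τ n).fst (d n : (τ n).space) = x n := congrArg Subtype.val h1
    rw [h6] at h5
    have h7 := norm_map_le (τ n).snd (d n : (τ n).space)
    change ‖(τ n).snd (d n : (τ n).space)‖ ≤ r + 1
    linarith
  obtain ⟨a, ha⟩ := A.isLSeminorm.exists_tendsto U _ hlb hrb
  refine ⟨a, A.isLSeminorm.le_of_tendsto ha hlb, ?_⟩
  refine Rep.of_tendsto (fun n => (d n : (τ n).space)) (l := l) ?_ ?_ ?_
  · filter_upwards [hd] with n hn
    rw [complexify_coe (τ n).space.isLSeminorm]
    exact hn.2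
  · exact (continuous_subtype_val.tendsto a).comp ha
  · filter_upwards [hd] with n hn
    exact congrArg Subtype.val hn.1

theorem exists_rep_of_complexify_le (hF : IsAdmissible F)
    (hτ : Tendsto (fun n => (τ n).extent) U (𝓝 0)) {x : ∀ n, As n} {l : ℝ≥0} {r : ℝ}
    (hl : ∀ᶠ n in U, complexify (As n).L (x n) ≤ l) (hr : ∀ᶠ n in U, ‖x n‖ ≤ r) :
    ∃ a : A, Rep U τ a x := by
  have hlt : (l : ℝ≥0∞) < (l + 1 : ℝ≥0) := by exact_mod_cast lt_add_one l
  obtain ⟨b, -, hb⟩ := exists_rep_of_lift_le (τ := τ) (x := fun n => ℜ (x n)) (l := l + 1) (r := r)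
    hτ (hl.mono fun n hn => ((le_max_left _ _).trans hn).trans_lt hlt)
    (hr.mono fun n hn => le_trans (realPart.norm_le (x n) :) hn)
  obtain ⟨c, -, hc⟩ := exists_rep_of_lift_le (τ := τ) (x := fun n => ℑ (x n)) (l := l + 1) (r := r)
    hτ (hl.mono fun n hn => ((le_max_right _ _).trans hn).trans_lt hlt)
    (hr.mono fun n hn => le_trans (imaginaryPart.norm_le (x n) :) hn)
  refine ⟨b + Complex.I • (c : A), ?_⟩
  have h := hb.add (hc.smul hF hτ Complex.I)
  simpa only [realPart_add_I_smul_imaginaryPart] using h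

/-- The elements represented by finer and finer approximations form a Cauchy sequence in `A`, and
its limit is represented by `x`. The rate 4 is two approximation errors times the factor 2 of
`Rep.norm_le`. -/
theorem exists_rep_of_approx (hF : IsAdmissible F)
    (hτ : Tendsto (fun n => (τ n).extent) U (𝓝 0)) {x : ∀ n, As n}
    (h : ∀ ε : ℝ, 0 < ε → ∃ a' x', Rep U τ a' x' ∧ ∀ᶠ n in U, ‖x' n - x n‖ ≤ ε) :
    ∃ a, Rep U τ a x := by
  have hpos : ∀ k : ℕ, (0 : ℝ) < 1 / ((k : ℝ) + 1) := fun k => by positivity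
  choose b y hb hy using fun k : ℕ => h (1 / ((k : ℝ) + 1)) (hpos k)
  have hlim : Tendsto (fun k : ℕ => 4 * (1 / ((k : ℝ) + 1))) atTop (𝓝 0) := by
    simpa only [mul_zero] using
      (tendsto_one_div_add_atTop_nhds_zero_nat (𝕜 := ℝ)).const_mul 4
  have hcau : CauchySeq b := by
    refine cauchySeq_of_le_tendsto_0 (fun k : ℕ => 4 * (1 / ((k : ℝ) + 1))) (fun n m N hn hm => ?_)
      hlim
    rw [dist_eq_norm]
    refine le_of_forall_pos_le_add fun δ hδ => ?_
    obtain ⟨i, h1, h2, h3⟩ := ((((hb n).sub hF hτ (hb m)).norm_le hτ hδ).and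
      ((hy n).and (hy m))).exists
    have h4 := norm_sub_le_norm_sub_add_norm_sub (y n i) (x i) (y m i)
    rw [norm_sub_rev (x i)] at h4
    have h5 : (1 : ℝ) / ((n : ℝ) + 1) ≤ 1 / ((N : ℝ) + 1) := by gcongr
    have h6 : (1 : ℝ) / ((m : ℝ) + 1) ≤ 1 / ((N : ℝ) + 1) := by gcongr
    linarith [h1.2]
  obtain ⟨a, ha⟩ := cauchySeq_tendsto_of_complete hcau
  refine ⟨a, Rep.closed fun ε hε => ?_⟩
  have h1 := ha.eventually (Metric.closedBall_mem_nhds a hε)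
  have h2 := (tendsto_one_div_add_atTop_nhds_zero_nat (𝕜 := ℝ)).eventually_le_const hε
  obtain ⟨k, hk1, hk2⟩ := (h1.and h2).exists
  refine ⟨b k, y k, hb k, by rwa [← mem_closedBall_iff_norm], (hy k).mono fun n hn => hn.trans hk2⟩

theorem complexify_apply_le {A : QCMS F} {θ : A →⋆ₐ[ℂ] A} {k : ℝ≥0}
    (hθ : LipschitzBound k A.L A.L θ) (a : A) {l : ℝ≥0} (ha : complexify A.L a ≤ l) :
    complexify A.L (θ a) ≤ k * l := by
  rw [complexify, realPart_map, imaginaryPart_map]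
  obtain ⟨h1, h2⟩ := max_le_iff.1 ha
  exact max_le ((hθ _ (ne_top_of_le_ne_top ENNReal.coe_ne_top h1)).trans (by gcongr))
    ((hθ _ (ne_top_of_le_ne_top ENNReal.coe_ne_top h2)).trans (by gcongr))

/-- The terms `x n` need not have bounded seminorm, but they are close to images of lifts that do.
The uniform Lipschitz bound preserves this, so compactness applies to the approximants. -/
theorem exists_rep_apply (hF : IsAdmissible F)
    (hτ : Tendsto (fun n => (τ n).extent) U (𝓝 0)) {θ : ∀ n, As n →⋆ₐ[ℂ] As n} {k : ℕ → ℝ≥0}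
    {κ : ℝ≥0} (hθ : ∀ n, LipschitzBound (k n) (As n).L (As n).L (θ n)) (hk : ∀ᶠ n in U, k n ≤ κ)
    {a : A} {x : ∀ n, As n} (h : Rep U τ a x) : ∃ b, Rep U τ b (fun n => θ n (x n)) := by
  refine exists_rep_of_approx hF hτ fun ε hε => ?_
  obtain ⟨l, hl⟩ := h ε hε
  obtain ⟨d, hd⟩ := skolem.1 hl
  have hy : ∀ᶠ n in U, complexify (As n).L (θ n ((τ n).fst (d n))) ≤ (κ * l : ℝ≥0) := by
    filter_upwards [hd, hk] with n hn hkn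
    have h1 := (complexify_map_le (τ n).fst_isometry (d n)).trans hn.1
    refine (complexify_apply_le (hθ n) _ h1).trans ?_
    rw [ENNReal.coe_mul]
    gcongr
  have hb : ∀ᶠ n in U, ‖θ n ((τ n).fst (d n))‖ ≤ 2 * ‖a‖ + 1 + ε := by
    filter_upwards [hd, h.norm_le hτ one_pos] with n hn hx
    have h1 := norm_map_le (θ n) ((τ n).fst (d n))
    have h2 := abs_le.1 (abs_norm_sub_norm_le ((τ n).fst (d n)) (x n))
    linarith [h2.2, hn.2.2, hx.1]
  obtain ⟨b, hb⟩ := exists_rep_of_complexify_le hF hτ hy hb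
  refine ⟨b, _, hb, ?_⟩
  filter_upwards [hd] with n hn
  rw [← map_sub]
  exact (norm_map_le _ _).trans hn.2.2

/-- Uniformly Lipschitz endomorphisms of `As n` induce an endomorphism of the limit. -/
theorem exists_starAlgHom (hF : IsAdmissible F) (hU : (U : Filter ℕ) ≤ atTop)
    (hτ : Tendsto (fun n => (τ n).extent) U (𝓝 0)) {θ : ∀ n, As n →⋆ₐ[ℂ] As n} {k : ℕ → ℝ≥0}
    {κ : ℝ≥0} (hθ : ∀ n, LipschitzBound (k n) (As n).L (As n).L (θ n))
    (hk : ∀ᶠ n in U, k n ≤ κ) :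
    ∃ α : A →⋆ₐ[ℂ] A, ∀ a x, Rep U τ a x → Rep U τ (α a) (fun n => θ n (x n)) := by
  -- The choice of representative is immaterial: two representatives differ by a null sequence and
  -- the morphisms are contractive. Every algebraic identity then follows from uniqueness.
  choose X hX using exists_rep hU hτ (A := A)
  choose α hα using fun a => exists_rep_apply hF hτ hθ hk (hX a)
  have key : ∀ a x, Rep U τ a x → Rep U τ (α a) (fun n => θ n (x n)) := by
    intro a x hx
    refine (hα a).congr fun ε hε => ?_
    filter_upwards [(hX a).eventually_norm_sub_le hF hτ hx hε] with n hn
    rw [← map_sub]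
    exact (norm_map_le _ _).trans hn
  have hscalar : ∀ z : ℂ, α (algebraMap ℂ A z) = algebraMap ℂ A z := fun z => by
    refine (key _ _ (Rep.scalar z)).unique hF hτ ?_
    simp only [AlgHomClass.commutes]
    exact Rep.scalar z
  refine ⟨{ toFun := α, map_one' := ?_, map_mul' := fun a b => ?_, map_zero' := ?_,
            map_add' := fun a b => ?_, commutes' := hscalar, map_star' := fun a => ?_ }, key⟩
  · simpa using hscalar 1
  · refine (key _ _ ((hX a).mul hF hτ (hX b))).unique hF hτ ?_
    simp only [map_mul]
    exact (hα a).mul hF hτ (hα b)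
  · simpa using hscalar 0
  · refine (key _ _ ((hX a).add (hX b))).unique hF hτ ?_
    simp only [map_add]
    exact (hα a).add (hα b)
  · refine (key _ _ (hX a).map_star).unique hF hτ ?_
    simp only [map_star]
    exact (hα a).map_star

end Existence

/-! ### Passing Lipschitz constants, norm estimates and lengths to the limit -/

section Limits

variable {F : ℝ≥0∞ → ℝ≥0∞ → ℝ≥0∞ → ℝ≥0∞ → ℝ≥0∞}
variable {As : ℕ → QCMS F} {A : QCMS F} {U : Ultrafilter ℕ} {τ : ∀ n, Tunnel (As n) A}

/-- For elements of finite seminorm the lifts are exact, so the representative satisfies the same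
strict bound at every index. -/
theorem exists_rep_of_lt {a : selfAdjoint A} {l : ℝ≥0} (ha : A.L a < l) :
    ∃ x : ∀ n, selfAdjoint (As n), (∀ n, (As n).L (x n) < l) ∧
      Rep U τ (a : A) (fun n => (x n : As n)) := by
  choose d hd hdl using fun n => (τ n).snd_isometry.exists_lift ha
  refine ⟨fun n => saMap (τ n).fst (d n), fun n => ((τ n).fst_isometry.map_le _).trans_lt (hdl n),
    Rep.of_lift (l := l) (Eventually.of_forall fun n => ⟨d n, ?_, congrArg Subtype.val (hd n), rfl⟩)⟩
  rw [complexify_coe (τ n).space.isLSeminorm]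
  exact (hdl n).le

/-- The slack `t` provides the strict inequalities that lifting through quotient seminorms demands;
it is then sent to zero. -/
theorem lipschitzBound_of_tendsto (hF : IsAdmissible F)
    (hτ : Tendsto (fun n => (τ n).extent) U (𝓝 0)) {θ : ∀ n, As n →⋆ₐ[ℂ] As n} {k : ℕ → ℝ≥0}
    {k₀ : ℝ≥0} (hθ : ∀ n, LipschitzBound (k n) (As n).L (As n).L (θ n))
    (hk : Tendsto k U (𝓝 k₀)) {α : A →⋆ₐ[ℂ] A}
    (hα : ∀ a x, Rep U τ a x → Rep U τ (α a) (fun n => θ n (x n))) :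
    LipschitzBound k₀ A.L A.L α := by
  intro a ha
  lift A.L a to ℝ≥0 using ha with l hl
  have key : ∀ t : ℝ≥0, 0 < t → A.L (saMap α a) ≤ ((k₀ + t) * (l + t) : ℝ≥0) := by
    intro t ht
    obtain ⟨x, hx, hax⟩ := exists_rep_of_lt (As := As) (U := U) (τ := τ) (a := a) (l := l + t)
      (by rw [← hl]; exact_mod_cast lt_add_of_pos_right l ht)
    have h1 : ∀ᶠ n in U, (As n).L (saMap (θ n) (x n)) < ((k₀ + t) * (l + t) : ℝ≥0) := by
      filter_upwards [hk.eventually_lt_const (lt_add_of_pos_right k₀ ht)] with n hn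
      refine ((hθ n (x n) (hx n).ne_top).trans (mul_le_mul_right (hx n).le _)).trans_lt ?_
      rw [← ENNReal.coe_mul, ENNReal.coe_lt_coe]
      exact mul_lt_mul_of_pos_right hn (by positivity)
    obtain ⟨b, hb, hbx⟩ := exists_rep_of_lift_le hτ h1 (r := 2 * ‖(a : A)‖ + 1) (by
      filter_upwards [hax.norm_le hτ one_pos] with n hn
      exact (norm_map_le (θ n) _).trans hn.1)
    have : saMap α a = b := Subtype.ext ((hα _ _ hax).unique hF hτ hbx)
    rwa [this]
  have ht : Tendsto (fun t : ℝ≥0 => (((k₀ + t) * (l + t) : ℝ≥0) : ℝ≥0∞)) (𝓝[>] 0)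
      (𝓝 ((k₀ * l : ℝ≥0) : ℝ≥0∞)) := by
    refine ENNReal.tendsto_coe.2 (Tendsto.mono_left ?_ nhdsWithin_le_nhds)
    have hc : Continuous fun t : ℝ≥0 => (k₀ + t) * (l + t) := by fun_prop
    simpa using hc.tendsto 0
  rw [← ENNReal.coe_mul]
  exact ge_of_tendsto ht (eventually_mem_nhdsWithin.mono fun t h => key t h)

/-- A uniform estimate for the difference of two sequences of morphisms passes to the limit. -/
theorem norm_sub_le_of_eventually (hF : IsAdmissible F)
    (hτ : Tendsto (fun n => (τ n).extent) U (𝓝 0)) {θ η : ∀ n, As n →⋆ₐ[ℂ] As n}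
    {α β : A →⋆ₐ[ℂ] A} (hα : ∀ a x, Rep U τ a x → Rep U τ (α a) (fun n => θ n (x n)))
    (hβ : ∀ a x, Rep U τ a x → Rep U τ (β a) (fun n => η n (x n))) {M : ℝ≥0}
    (hM : ∀ᶠ n in U, ∀ (x : selfAdjoint (As n)) (l : ℝ≥0), (As n).L x ≤ l → 0 < l →
      ‖θ n (x : As n) - η n (x : As n)‖ ≤ M * l)
    {a : selfAdjoint A} {l : ℝ≥0} (ha : A.L a ≤ l) :
    ‖α (a : A) - β (a : A)‖ ≤ M * l := by
  have key : ∀ t : ℝ≥0, 0 < t → ‖α (a : A) - β (a : A)‖ ≤ M * (l + t) + t := by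
    intro t ht
    obtain ⟨x, hx, hax⟩ := exists_rep_of_lt (As := As) (U := U) (τ := τ) (a := a) (l := l + t)
      (ha.trans_lt (by exact_mod_cast lt_add_of_pos_right l ht))
    have h := ((hα _ _ hax).sub hF hτ (hβ _ _ hax)).norm_le_of_selfAdjoint hτ
      ((a.2.map α).sub (a.2.map β)) (fun n => ((x n).2.map (θ n)).sub ((x n).2.map (η n)))
      (δ := t) (by exact_mod_cast ht)
    obtain ⟨n, h1, h2⟩ := (h.and hM).exists
    have h3 := h2 (x n) (l + t) (hx n).le (by positivity)
    push_cast at h3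
    linarith [h1.2]
  have ht : Tendsto (fun t : ℝ≥0 => (M : ℝ) * (l + t) + t) (𝓝[>] 0) (𝓝 (M * l)) := by
    refine Tendsto.mono_left ?_ nhdsWithin_le_nhds
    have hc : Continuous fun t : ℝ≥0 => (M : ℝ) * (l + t) + t := by fun_prop
    simpa using hc.tendsto 0
  exact ge_of_tendsto ht (eventually_mem_nhdsWithin.mono fun t h => key t h)

/-- The domain of the seminorm spans a dense subspace and morphisms are contractive. -/
theorem starAlgHom_ext {B : Type*} [CStarAlgebra B] {π ρ : A →⋆ₐ[ℂ] B}
    (h : ∀ a : selfAdjoint A, A.L a ≠ ∞ → π (a : A) = ρ (a : A)) : π = ρ := by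
  refine StarAlgHom.ext fun a => ?_
  rw [← sub_eq_zero, ← norm_le_zero_iff]
  refine le_of_forall_pos_le_add fun ε hε => ?_
  obtain ⟨b, hb, hba⟩ := exists_complexify_ne_top A.isLSeminorm a (half_pos hε)
  have h1 : π b = ρ b := by
    rw [← realPart_add_I_smul_imaginaryPart b]
    simp only [map_add, map_smul]
    rw [h _ (ne_top_of_le_ne_top hb (le_max_left _ _)),
      h _ (ne_top_of_le_ne_top hb (le_max_right _ _))]
  have h2 : π a - ρ a = ρ (b - a) - π (b - a) := by
    rw [map_sub, map_sub, h1]; abel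
  rw [h2]
  refine (norm_sub_le _ _).trans ?_
  linarith [norm_map_le π (b - a), norm_map_le ρ (b - a)]

theorem enorm_sub_le_mul_mkLength (B : QCMS F) (π : B ≃⋆ₐ[ℂ] B) {a : selfAdjoint B} {l : ℝ≥0}
    (hl : 0 < l) (ha : B.L a ≤ l) : ‖(a : B) - π (a : B)‖ₑ ≤ l * mkLength B.L π := by
  have hle : ‖(l : ℝ)‖ₑ = l := by
    rw [enorm_eq_nnnorm]; simp
  set b : selfAdjoint B := ((l : ℝ)⁻¹) • a with hb
  have hab : a = (l : ℝ) • b := by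
    rw [hb, smul_inv_smul₀]; exact_mod_cast hl.ne'
  have hb1 : B.L b ≤ 1 := by
    have h : (l : ℝ≥0∞) * B.L b ≤ l * 1 := by
      rw [← hle, ← B.isLSeminorm.smul_eq, ← hab, hle, mul_one]
      exact ha
    exact (ENNReal.mul_le_mul_iff_right (by exact_mod_cast hl.ne') ENNReal.coe_ne_top).1 h
  have h1 : (a : B) - π (a : B) = (l : ℂ) • ((b : B) - π (b : B)) := by
    have : (a : B) = (l : ℂ) • (b : B) := by
      conv_lhs => rw [hab]
      rw [selfAdjoint.val_smul, ← Complex.coe_smul]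
    rw [this, map_smul, smul_sub]
  have h2 : ‖(l : ℂ)‖ₑ = l := by
    rw [enorm_eq_nnnorm]; simp
  rw [h1, enorm_smul, h2]
  gcongr
  exact le_iSup₂ (f := fun (a : selfAdjoint B) (_ : B.L a ≤ 1) => ‖(a : B) - π (a : B)‖ₑ) b hb1

theorem norm_sub_le_mul_mkLength (B : QCMS F) (π : B ≃⋆ₐ[ℂ] B) {a : selfAdjoint B} {l M : ℝ≥0}
    (hl : 0 < l) (ha : B.L a ≤ l) (hM : mkLength B.L π ≤ M) :
    ‖(a : B) - π (a : B)‖ ≤ l * M := by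
  have h := (enorm_sub_le_mul_mkLength B π hl ha).trans (mul_le_mul_right hM _)
  rw [enorm_eq_nnnorm] at h
  exact_mod_cast h

/-- Any finite number above the limsup bounds the lengths eventually, and this estimate on the
displacement from the identity passes to the limit. -/
theorem mkLength_le_limsup (hF : IsAdmissible F) (hU : (U : Filter ℕ) ≤ atTop)
    (hτ : Tendsto (fun n => (τ n).extent) U (𝓝 0)) {θ : ∀ n, As n ≃⋆ₐ[ℂ] As n}
    {α : A ≃⋆ₐ[ℂ] A} (hα : ∀ a x, Rep U τ a x → Rep U τ (α a) (fun n => θ n (x n))) :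
    mkLength A.L α ≤ limsup (fun n => mkLength (As n).L (θ n)) atTop := by
  refine iSup₂_le fun a ha => le_of_not_gt fun hlt => ?_
  obtain ⟨M, hM, hM'⟩ := ENNReal.lt_iff_exists_nnreal_btwn.1 hlt
  refine hM'.not_ge ?_
  have h1 : ∀ᶠ n in U, mkLength (As n).L (θ n) < M := hU (eventually_lt_of_limsup_lt hM)
  have h2 := norm_sub_le_of_eventually hF hτ (θ := fun n => StarAlgHom.id ℂ (As n))
    (η := fun n => (θ n : As n →⋆ₐ[ℂ] As n)) (α := StarAlgHom.id ℂ A) (β := (α : A →⋆ₐ[ℂ] A))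
    (fun a x h => h) hα (M := M) (by
      filter_upwards [h1] with n hn x l hx hl
      rw [mul_comm]
      exact norm_sub_le_mul_mkLength (As n) (θ n) hl hx hn.le) (l := 1) (by simpa using ha)
  rw [NNReal.coe_one, mul_one] at h2
  rw [enorm_eq_nnnorm, ENNReal.coe_le_coe]
  exact h2

/-- Elements of bounded seminorm are uniformly bounded modulo scalars along a sequence of tunnels
of vanishing extent. -/
theorem exists_norm_sub_algebraMap_le (hτ : Tendsto (fun n => (τ n).extent) U (𝓝 0))
    {x : ∀ n, selfAdjoint (As n)} {l : ℝ≥0} (hx : ∀ᶠ n in U, (As n).L (x n) < l) :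
    ∃ (C : ℝ) (t : ℕ → ℝ), ∀ᶠ n in U, ‖(x n : As n) - algebraMap ℂ (As n) (t n)‖ ≤ C := by
  obtain ⟨M, hM⟩ := A.isLSeminorm.exists_norm_sub_algebraMap_le
  suffices h : ∀ᶠ n in U, ∃ t : ℝ, ‖(x n : As n) - algebraMap ℂ (As n) t‖ ≤ 2 * (l * M) + 1 by
    obtain ⟨t, ht⟩ := skolem.1 h
    exact ⟨_, t, ht⟩
  filter_upwards [hx, eventually_norm_le_complexify hτ l one_pos] with n hn hnorm
  obtain ⟨d, hd, hdl⟩ := (τ n).fst_isometry.exists_lift hn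
  obtain ⟨t, ht⟩ := hM (saMap (τ n).snd d) l (((τ n).snd_isometry.map_le d).trans hdl.le)
  refine ⟨t, ?_⟩
  have h1 : complexify (τ n).space.L ((d : (τ n).space) - algebraMap ℂ _ (t : ℂ)) ≤ l := by
    refine (complexify_sub_le (τ n).space.isLSeminorm _ _).trans ?_
    rw [complexify_algebraMap (τ n).space.isLSeminorm, complexify_coe (τ n).space.isLSeminorm,
      add_zero]
    exact hdl.le
  have h2 := (hnorm _ h1).2
  have h3 := norm_map_le (τ n).fst ((d : (τ n).space) - algebraMap ℂ _ (t : ℂ))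
  rw [map_sub, AlgHomClass.commutes] at h2 h3
  have h4 : (τ n).fst (d : (τ n).space) = x n := congrArg Subtype.val hd
  rw [h4] at h3
  have h5 : ‖(τ n).snd (d : (τ n).space) - algebraMap ℂ A (t : ℂ)‖ ≤ l * M := ht
  linarith

/-- Elements with displacement above `r` may be unbounded in norm, so no limit is available
directly. Subtracting scalars changes neither seminorm nor displacement and makes them bounded;
their limit then moves too much under `α`. -/
theorem liminf_le_mkLength (hF : IsAdmissible F) (hU : (U : Filter ℕ) ≤ atTop)
    (hτ : Tendsto (fun n => (τ n).extent) U (𝓝 0)) {θ : ∀ n, As n ≃⋆ₐ[ℂ] As n}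
    {α : A ≃⋆ₐ[ℂ] A} (hα : ∀ a x, Rep U τ a x → Rep U τ (α a) (fun n => θ n (x n))) :
    liminf (fun n => mkLength (As n).L (θ n)) atTop ≤ mkLength A.L α := by
  by_contra! hlt
  obtain ⟨r, hmr, hr⟩ := ENNReal.lt_iff_exists_nnreal_btwn.1 hlt
  obtain ⟨m, hm⟩ : ∃ m : ℝ≥0, (m : ℝ≥0∞) = mkLength A.L α := ⟨_, ENNReal.coe_toNNReal hmr.ne_top⟩
  rw [← hm, ENNReal.coe_lt_coe, ← NNReal.coe_lt_coe] at hmr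
  have hm0 : (0 : ℝ) ≤ m := m.2
  -- `1 + δ` is the seminorm bound left after making it strict for lifting, and the last `δ` is the
  -- error of the norm comparison.
  obtain ⟨δ, hδ, hδr⟩ : ∃ δ : ℝ≥0, 0 < δ ∧ (1 + δ) * (m : ℝ) + δ < r := by
    have h1 : 0 < ((r : ℝ) - m) / (m + 2) := div_pos (by linarith) (by linarith)
    refine ⟨(((r : ℝ) - m) / (m + 2)).toNNReal, Real.toNNReal_pos.2 h1, ?_⟩
    rw [Real.coe_toNNReal _ h1.le]
    have h2 : ((r : ℝ) - m) / (m + 2) * (m + 2) = r - m := by field_simp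
    nlinarith
  have hx : ∀ᶠ n in U, ∃ x : selfAdjoint (As n),
      (As n).L x ≤ 1 ∧ (r : ℝ) < ‖(x : As n) - θ n (x : As n)‖ := by
    filter_upwards [hU (eventually_lt_of_lt_liminf hr)] with n hn
    rw [mkLength, lt_iSup_iff] at hn
    obtain ⟨x, hn⟩ := hn
    obtain ⟨hx, hn⟩ := lt_iSup_iff.1 hn
    rw [enorm_eq_nnnorm, ENNReal.coe_lt_coe] at hn
    exact ⟨x, hx, hn⟩
  obtain ⟨x, hx⟩ := skolem.1 hx
  have h1δ : (1 : ℝ≥0∞) < (1 + δ : ℝ≥0) := by exact_mod_cast lt_add_of_pos_right 1 hδ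
  obtain ⟨C, t, hC⟩ := exists_norm_sub_algebraMap_le hτ (l := 1 + δ)
    (hx.mono fun n hn => hn.1.trans_lt h1δ)
  let s : ∀ n, selfAdjoint (As n) := fun n =>
    ⟨algebraMap ℂ (As n) (t n), IsSelfAdjoint.algebraMap (As n) (Complex.conj_ofReal _)⟩
  obtain ⟨b, hbl, hb⟩ := exists_rep_of_lift_le hτ (x := fun n => x n - s n) (l := 1 + δ) (r := C)
    (hx.mono fun n hn => by
      refine ((As n).isLSeminorm.sub_le _ _).trans_lt ?_
      rw [(As n).isLSeminorm.map_algebraMap (s n) (t n) rfl, add_zero]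
      exact hn.1.trans_lt h1δ) hC
  have h1 := (hb.sub hF hτ (hα _ _ hb)).norm_le_of_selfAdjoint hτ
    (b.2.sub (b.2.map α)) (fun n => ((x n - s n).2).sub ((x n - s n).2.map (θ n)))
    (δ := δ) (by exact_mod_cast hδ)
  obtain ⟨n, h2, h3⟩ := (h1.and hx).exists
  have h4 := norm_sub_le_mul_mkLength A α (M := m) (by positivity) hbl hm.ge
  have h5 : ((x n - s n : selfAdjoint (As n)) : As n) - θ n ((x n - s n : selfAdjoint (As n)) : As n)
      = (x n : As n) - θ n (x n : As n) := by
    rw [AddSubgroupClass.coe_sub, map_sub]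
    have : θ n (s n : As n) = s n := AlgHomClass.commutes (θ n) _
    rw [this]; abel
  rw [h5] at h2
  push_cast at h4
  linarith [h2.1, h3.2]

end Limits

/-! ### Strong continuity and averaging over a compact group -/

section Actions

variable {F : ℝ≥0∞ → ℝ≥0∞ → ℝ≥0∞ → ℝ≥0∞ → ℝ≥0∞}

theorem norm_sub_le_of_complexify_le {B : QCMS F} {π ρ : B →⋆ₐ[ℂ] B} {M : ℝ≥0}
    (h : ∀ a : selfAdjoint B, B.L a ≠ ∞ → ‖π (a : B) - ρ (a : B)‖ₑ ≤ M * B.L a) {b : B} {l : ℝ≥0}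
    (hb : complexify B.L b ≤ l) : ‖π b - ρ b‖ ≤ 2 * M * l := by
  have h1 : ∀ a : selfAdjoint B, B.L a ≤ l → ‖π (a : B) - ρ (a : B)‖ ≤ M * l := by
    intro a ha
    have h2 := (h a (ne_top_of_le_ne_top ENNReal.coe_ne_top ha)).trans (mul_le_mul_right ha _)
    rw [enorm_eq_nnnorm] at h2
    exact_mod_cast h2
  have e : π b - ρ b = (π (ℜ b : B) - ρ (ℜ b : B))
      + Complex.I • (π (ℑ b : B) - ρ (ℑ b : B)) := by
    conv_lhs => rw [← realPart_add_I_smul_imaginaryPart b]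
    simp only [map_add, map_smul]
    module
  rw [e]
  refine (norm_add_le _ _).trans ?_
  rw [norm_smul, Complex.norm_I, one_mul]
  linarith [h1 _ (max_le_iff.1 hb).1, h1 _ (max_le_iff.1 hb).2]

/-- The modulus `K` gives continuity on elements of finite seminorm; density and contractivity
extend it to all elements. -/
theorem continuous_of_enorm_sub_le {H : Type*} [Group H] [MetricSpace H] {B : QCMS F}
    {K : ℝ≥0 → ℝ≥0} (hK : Continuous K) (hK0 : K 0 = 0) {β : H →* (B ≃⋆ₐ[ℂ] B)}
    (hβ : ∀ (g h : H) (a : selfAdjoint B), B.L a ≠ ∞ →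
      ‖β g (a : B) - β h (a : B)‖ₑ ≤ K (nndist g h) * B.L a) (b : B) :
    Continuous fun g => β g b := by
  rw [continuous_iff_continuousAt]
  intro h
  rw [ContinuousAt, Metric.tendsto_nhds]
  intro ε hε
  obtain ⟨b', hb', hbb⟩ := exists_complexify_ne_top B.isLSeminorm b (ε := ε / 3) (by positivity)
  lift complexify B.L b' to ℝ≥0 using hb' with l hl
  have hlim : Tendsto (fun g : H => 2 * (K (nndist g h) : ℝ) * l) (𝓝 h) (𝓝 0) := by
    have hc : Continuous fun g : H => 2 * (K (nndist g h) : ℝ) * l := by fun_prop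
    simpa [hK0] using hc.tendsto h
  filter_upwards [hlim.eventually_lt_const (u := ε / 3) (by positivity)] with g hg
  have h1 := norm_sub_le_of_complexify_le (π := (β g : B →⋆ₐ[ℂ] B)) (ρ := (β h : B →⋆ₐ[ℂ] B))
    (hβ g h) hl.ge
  change ‖β g b' - β h b'‖ ≤ _ at h1
  have h2 := norm_map_le (β g : B →⋆ₐ[ℂ] B) (b' - b)
  have h3 := norm_map_le (β h : B →⋆ₐ[ℂ] B) (b' - b)
  change ‖β g (b' - b)‖ ≤ _ at h2
  change ‖β h (b' - b)‖ ≤ _ at h3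
  have e : β g b - β h b = (β g b' - β h b') - β g (b' - b) + β h (b' - b) := by
    rw [map_sub, map_sub]; abel
  rw [dist_eq_norm, e]
  have h4 := norm_add_le ((β g b' - β h b') - β g (b' - b)) (β h (b' - b))
  have h5 := norm_sub_le (β g b' - β h b') (β g (b' - b))
  linarith

open MeasureTheory in
/-- Averaging over the group: for an ergodic strongly continuous action of a compact group, an
element which is moved little is close to a scalar. -/
theorem IsErgodic.exists_norm_sub_algebraMap_le {H B : Type*} [Group H] [MetricSpace H]
    [CompactSpace H] [IsTopologicalGroup H] [CStarAlgebra B] {β : H →* (B ≃⋆ₐ[ℂ] B)}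
    (hβ : IsErgodic β) (hc : ∀ b, Continuous fun g => β g b) {b : B} {r : ℝ}
    (hb : ∀ g, ‖β g b - b‖ ≤ r) : ∃ z : ℂ, ‖b - algebraMap ℂ B z‖ ≤ r := by
  borelize H
  let K₀ : TopologicalSpace.PositiveCompacts H := ⊤
  let μ : Measure H := Measure.haarMeasure K₀
  have hμ : μ Set.univ = 1 := Measure.haarMeasure_self (K₀ := K₀)
  have : IsProbabilityMeasure μ := ⟨hμ⟩
  have hint : Integrable (fun g => β g b) μ :=
    (hc b).integrable_of_hasCompactSupport (HasCompactSupport.of_compactSpace _)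
  -- The average is fixed by left invariance of Haar measure, hence scalar by ergodicity, and lies
  -- within `r` of `b` because the orbit does.
  set c := ∫ g, β g b ∂μ with hcdef
  have hfix : ∀ h, β h c = c := by
    intro h
    let T : B →L[ℂ] B := ⟨(β h : B →⋆ₐ[ℂ] B).toAlgHom.toLinearMap,
      (AddMonoidHomClass.continuous_of_bound (β h : B →⋆ₐ[ℂ] B) 1 fun x => by
        rw [one_mul]; exact NonUnitalStarAlgHom.norm_apply_le _ x)⟩
    calc β h c = T c := rfl
      _ = ∫ g, T (β g b) ∂μ := (T.integral_comp_comm hint).symm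
      _ = ∫ g, β (h * g) b ∂μ := by
        refine integral_congr_ae (Eventually.of_forall fun g => ?_)
        change β h (β g b) = β (h * g) b
        rw [map_mul]; rfl
      _ = c := integral_mul_left_eq_self (fun g => β g b) h
  obtain ⟨z, hz⟩ : c ∈ Set.range (algebraMap ℂ B) := hβ ▸ hfix
  refine ⟨z, ?_⟩
  rw [hz, norm_sub_rev]
  have e : c - b = ∫ g, (β g b - b) ∂μ := by
    rw [integral_sub hint (integrable_const b), integral_const, probReal_univ, one_smul]
  rw [e]
  refine (norm_integral_le_of_norm_le_const (Eventually.of_forall hb)).trans_eq ?_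
  rw [probReal_univ, mul_one]

end Actions

/-! ### Limits of almost scalar sequences -/

section ErgodicLimit

variable {F : ℝ≥0∞ → ℝ≥0∞ → ℝ≥0∞ → ℝ≥0∞ → ℝ≥0∞}
variable {As : ℕ → QCMS F} {A : QCMS F} {U : Ultrafilter ℕ} {τ : ∀ n, Tunnel (As n) A}

/-- The approximating scalars are bounded, so they converge along `U`, and constant scalar sequences
represent scalars. Scalars form a closed set, so an approximation of `a` by such limits suffices. -/
theorem exists_eq_algebraMap_of_rep (hF : IsAdmissible F)
    (hτ : Tendsto (fun n => (τ n).extent) U (𝓝 0)) {a : A} {x : ∀ n, As n} (h : Rep U τ a x)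
    (hx : ∀ ε : ℝ, 0 < ε → ∀ᶠ n in U, ∃ z : ℂ, ‖x n - algebraMap ℂ (As n) z‖ ≤ ε) :
    a ∈ Set.range (algebraMap ℂ A) := by
  have hclosed : IsClosed (Set.range (algebraMap ℂ A)) :=
    (algebraMap_isometry ℂ A).isClosedEmbedding.isClosed_range
  rw [← hclosed.closure_eq, Metric.mem_closure_iff]
  intro ε hε
  obtain ⟨z, hz⟩ := skolem.1 (hx (ε / 5) (by positivity))
  have hbdd : ∀ᶠ n in U, z n ∈ Metric.closedBall (0 : ℂ) (2 * ‖a‖ + 1 + ε) := by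
    filter_upwards [hz, h.norm_le hτ one_pos] with n h1 h2
    rw [mem_closedBall_zero_iff, ← norm_algebraMap' (As n)]
    have := norm_sub_norm_le (algebraMap ℂ (As n) (z n)) (x n)
    rw [norm_sub_rev] at this
    linarith [h2.1]
  obtain ⟨w, -, hw⟩ := (isCompact_closedBall (0 : ℂ) (2 * ‖a‖ + 1 + ε)).ultrafilter_le_nhds
    (U.map z) (le_principal_iff.2 hbdd)
  refine ⟨algebraMap ℂ A w, ⟨w, rfl⟩, ?_⟩
  obtain ⟨n, h1, h2, h3⟩ := (((h.sub hF hτ (Rep.scalar w)).norm_le hτ (δ := ε / 10)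
    (by positivity)).and (hz.and
      (hw (Metric.closedBall_mem_nhds w (ε := ε / 10) (by positivity))))).exists
  have h4 : ‖z n - w‖ ≤ ε / 10 := by rwa [← mem_closedBall_iff_norm]
  rw [← norm_algebraMap' (As n), map_sub] at h4
  have h5 := norm_sub_le_norm_sub_add_norm_sub (x n) (algebraMap ℂ (As n) (z n))
    (algebraMap ℂ (As n) w)
  rw [dist_eq_norm]
  linarith [h1.2]

end ErgodicLimit

/-! ### The limit action, its continuity and its ergodicity -/

section LimitActions

variable {F : ℝ≥0∞ → ℝ≥0∞ → ℝ≥0∞ → ℝ≥0∞ → ℝ≥0∞}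
variable {As : ℕ → QCMS F} {A : QCMS F} {U : Ultrafilter ℕ} {τ : ∀ n, Tunnel (As n) A}
variable {G : Type*} [Group G] [MetricSpace G]
  {Gs : ℕ → Type*} [∀ n, Group (Gs n)] [∀ n, MetricSpace (Gs n)]
  {ε : ℕ → ℝ} {ς : ∀ n, Gs n → G} {ϰ : ∀ n, G → Gs n} {K : ℝ≥0 → ℝ≥0}
  {αs : ∀ n, Gs n →* (As n ≃⋆ₐ[ℂ] As n)}

theorem isErgodic_of_rep [CompactSpace G] [∀ n, CompactSpace (Gs n)] [∀ n, IsTopologicalGroup (Gs n)]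
    (hF : IsAdmissible F) (hU : (U : Filter ℕ) ≤ atTop)
    (hτ : Tendsto (fun n => (τ n).extent) U (𝓝 0)) (hε : Tendsto ε U (𝓝 0))
    (hnear : ∀ n, IsNearIsometricIso (ε n) (ς n) (ϰ n)) (hK : Continuous K) (hK0 : K 0 = 0)
    (hαs : ∀ n (g g' : Gs n) (a : selfAdjoint (As n)), (As n).L a ≠ ∞ →
      ‖αs n g (a : As n) - αs n g' (a : As n)‖ₑ ≤ K (nndist g g') * (As n).L a)
    {α : G →* (A ≃⋆ₐ[ℂ] A)}
    (hα : ∀ g a x, Rep U τ a x → Rep U τ (α g a) (fun n => αs n (ϰ n g) (x n)))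
    (herg : ∀ n, IsErgodic (αs n)) : IsErgodic α := by
  refine Set.Subset.antisymm (fun a ha => ?_) ?_
  swap
  · rintro _ ⟨z, rfl⟩ g
    exact AlgHomClass.commutes (α g) z
  obtain ⟨x, hx⟩ := exists_rep hU hτ a
  refine exists_eq_algebraMap_of_rep hF hτ hx fun e he => ?_
  obtain ⟨l, hl⟩ := hx (e / 8) (by positivity)
  obtain ⟨η, hη, hKη⟩ : ∃ η : ℝ, 0 < η ∧ ∀ t : ℝ≥0, t < η → 2 * (K t : ℝ) * l ≤ e / 8 := by
    have hc : Continuous fun t : ℝ≥0 => 2 * (K t : ℝ) * l := by fun_prop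
    have hlim : Tendsto (fun t : ℝ≥0 => 2 * (K t : ℝ) * l) (𝓝 0) (𝓝 0) := by
      simpa [hK0] using hc.tendsto 0
    obtain ⟨η, hη, h⟩ := Metric.eventually_nhds_iff.1
      (hlim.eventually_le_const (u := e / 8) (by positivity))
    exact ⟨η, hη, fun t ht => h (by simpa [NNReal.dist_eq] using ht)⟩
  -- Being almost fixed is known along `U` only for one element of `G` at a time, hence for the
  -- finitely many elements of a net. The near isometries place every element of `Gs n` within `η`
  -- of the image of the net, where equicontinuity takes over.
  obtain ⟨t, -, htfin, ht⟩ := finite_cover_balls_of_compact (isCompact_univ (X := G))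
    (e := η / 3) (by positivity)
  have hfix : ∀ᶠ n in U, ∀ h ∈ t, ‖αs n (ϰ n h) (x n) - x n‖ ≤ e / 8 := by
    refine (htfin.eventually_all).2 fun h _ => ?_
    have h1 := hα h a x hx
    rw [show α h a = a from ha h] at h1
    exact h1.eventually_norm_sub_le hF hτ hx (by positivity)
  filter_upwards [hl, hfix, hε.eventually_lt_const (u := η / 3) (by positivity)] with
    n ⟨d, hd, _, hdx⟩ hn hεn
  -- Equicontinuity needs a finite seminorm, so `y` replaces `x n`. Moving `y` costs four terms of
  -- size `e / 8`.
  set y := (τ n).fst d with hy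
  have hyl : complexify (As n).L y ≤ l := (complexify_map_le (τ n).fst_isometry d).trans hd
  have hmove : ∀ g : Gs n, ‖αs n g y - y‖ ≤ e / 2 := by
    intro g
    obtain ⟨h, hht, hgh⟩ := Set.mem_iUnion₂.1 (ht (Set.mem_univ (ς n g)))
    rw [Metric.mem_ball] at hgh
    have hd1 : dist g (ϰ n h) < η := by
      have h1 := (hnear n).inv₁ g
      have h2 := (abs_le.1 ((hnear n).dist₂ (ς n g) h)).2
      have h3 := dist_triangle g (ϰ n (ς n g)) (ϰ n h)
      rw [dist_comm g (ϰ n (ς n g))] at h3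
      linarith
    have h1 := norm_sub_le_of_complexify_le (π := (αs n g : As n →⋆ₐ[ℂ] As n))
      (ρ := (αs n (ϰ n h) : As n →⋆ₐ[ℂ] As n)) (hαs n g (ϰ n h)) hyl
    change ‖αs n g y - αs n (ϰ n h) y‖ ≤ _ at h1
    have h2 := hKη (nndist g (ϰ n h)) (by rwa [coe_nndist])
    have h3 : ‖αs n (ϰ n h) (y - x n)‖ ≤ ‖y - x n‖ :=
      norm_map_le (αs n (ϰ n h) : As n →⋆ₐ[ℂ] As n) (y - x n)
    have h4 := hn h hht
    have e1 : αs n g y - y = (αs n g y - αs n (ϰ n h) y) + αs n (ϰ n h) (y - x n)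
        + (αs n (ϰ n h) (x n) - x n) - (y - x n) := by
      rw [map_sub]; abel
    rw [e1]
    have n1 := norm_sub_le ((αs n g y - αs n (ϰ n h) y) + αs n (ϰ n h) (y - x n)
        + (αs n (ϰ n h) (x n) - x n)) (y - x n)
    have n2 := norm_add_le ((αs n g y - αs n (ϰ n h) y) + αs n (ϰ n h) (y - x n))
      (αs n (ϰ n h) (x n) - x n)
    have n3 := norm_add_le (αs n g y - αs n (ϰ n h) y) (αs n (ϰ n h) (y - x n))
    linarith
  obtain ⟨z, hz⟩ := (herg n).exists_norm_sub_algebraMap_le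
    (continuous_of_enorm_sub_le hK hK0 (hαs n)) hmove
  refine ⟨z, ?_⟩
  have h1 := norm_sub_le_norm_sub_add_norm_sub (x n) y (algebraMap ℂ (As n) z)
  rw [norm_sub_rev (x n) y] at h1
  linarith

/-- Two morphisms induced by sequences of morphisms which are asymptotically equal, uniformly
relative to the seminorms, coincide. -/
theorem eq_of_rep (hF : IsAdmissible F) (hτ : Tendsto (fun n => (τ n).extent) U (𝓝 0))
    {θ η : ∀ n, As n →⋆ₐ[ℂ] As n} {α β : A →⋆ₐ[ℂ] A}
    (hα : ∀ a x, Rep U τ a x → Rep U τ (α a) (fun n => θ n (x n)))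
    (hβ : ∀ a x, Rep U τ a x → Rep U τ (β a) (fun n => η n (x n))) {M : ℕ → ℝ≥0}
    (hM0 : Tendsto M U (𝓝 0))
    (hM : ∀ n (x : selfAdjoint (As n)), (As n).L x ≠ ∞ →
      ‖θ n (x : As n) - η n (x : As n)‖ₑ ≤ M n * (As n).L x) : α = β := by
  refine starAlgHom_ext fun a ha => ?_
  lift A.L a to ℝ≥0 using ha with l hl
  rw [← sub_eq_zero, ← norm_le_zero_iff]
  have key : ∀ t : ℝ≥0, 0 < t → ‖α (a : A) - β (a : A)‖ ≤ t * l := fun t ht => by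
    refine norm_sub_le_of_eventually hF hτ hα hβ ?_ hl.ge
    filter_upwards [hM0.eventually_le_const ht] with n hn x k hx _
    have h := (hM n x (ne_top_of_le_ne_top ENNReal.coe_ne_top hx)).trans
      (mul_le_mul' (ENNReal.coe_le_coe.2 hn) hx)
    rw [enorm_eq_nnnorm] at h
    exact_mod_cast h
  have hlim : Tendsto (fun t : ℝ≥0 => (t : ℝ) * l) (𝓝[>] 0) (𝓝 0) := by
    refine Tendsto.mono_left ?_ nhdsWithin_le_nhds
    have hc : Continuous fun t : ℝ≥0 => (t : ℝ) * l := by fun_prop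
    simpa using hc.tendsto 0
  exact ge_of_tendsto hlim (eventually_mem_nhdsWithin.mono fun t h => key t h)

theorem tendsto_nndist_map (hε : Tendsto ε U (𝓝 0))
    (hnear : ∀ n, IsNearIsometricIso (ε n) (ς n) (ϰ n)) (g h : G) :
    Tendsto (fun n => nndist (ϰ n g) (ϰ n h)) U (𝓝 (nndist g h)) := by
  rw [← NNReal.tendsto_coe]
  simp only [coe_nndist]
  rw [tendsto_iff_dist_tendsto_zero]
  exact squeeze_zero (fun _ => dist_nonneg) (fun n => (hnear n).dist₂ g h) hε

theorem tendsto_nndist_mul (hε : Tendsto ε U (𝓝 0))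
    (hnear : ∀ n, IsNearIsometricIso (ε n) (ς n) (ϰ n)) (g h : G) :
    Tendsto (fun n => nndist (ϰ n g * ϰ n h) (ϰ n (g * h))) U (𝓝 0) := by
  rw [← NNReal.tendsto_coe]
  simp only [coe_nndist, NNReal.coe_zero]
  exact squeeze_zero (fun _ => dist_nonneg) (fun n => (hnear n).mul₂ g h) hε

theorem tendsto_nndist_one (hε : Tendsto ε U (𝓝 0))
    (hnear : ∀ n, IsNearIsometricIso (ε n) (ς n) (ϰ n)) :
    Tendsto (fun n => nndist (ϰ n 1) 1) U (𝓝 0) := by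
  rw [← NNReal.tendsto_coe]
  simp only [coe_nndist, NNReal.coe_zero]
  exact squeeze_zero (fun _ => dist_nonneg) (fun n => (hnear n).one₂) hε

theorem exists_limit_action (hF : IsAdmissible F) (hU : (U : Filter ℕ) ≤ atTop)
    (hτ : Tendsto (fun n => (τ n).extent) U (𝓝 0)) (hε : Tendsto ε U (𝓝 0))
    (hnear : ∀ n, IsNearIsometricIso (ε n) (ς n) (ϰ n)) (hK : Continuous K) (hK0 : K 0 = 0)
    {k : G → ℕ → ℝ≥0} {D : G → ℝ≥0} (hk : ∀ g, Tendsto (k g) U (𝓝 (D g)))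
    (hlip : ∀ n g, LipschitzBound (k g n) (As n).L (As n).L
      (αs n (ϰ n g) : As n →⋆ₐ[ℂ] As n))
    (hαs : ∀ n (g g' : Gs n) (a : selfAdjoint (As n)), (As n).L a ≠ ∞ →
      ‖αs n g (a : As n) - αs n g' (a : As n)‖ₑ ≤ K (nndist g g') * (As n).L a) :
    ∃ α : G →* (A ≃⋆ₐ[ℂ] A),
      ∀ g a x, Rep U τ a x → Rep U τ (α g a) (fun n => αs n (ϰ n g) (x n)) := by
  have hex : ∀ g, ∃ α : A →⋆ₐ[ℂ] A, ∀ a x, Rep U τ a x →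
      Rep U τ (α a) (fun n => αs n (ϰ n g) (x n)) := fun g =>
    exists_starAlgHom hF hU hτ (hlip · g)
      ((hk g).eventually_le_const (u := D g + 1) (lt_add_one (D g)))
  choose α hα using hex
  have hKlim : ∀ {u : ℕ → ℝ≥0}, Tendsto u U (𝓝 0) → Tendsto (fun n => K (u n)) U (𝓝 0) := by
    intro u hu
    have h := (hK.tendsto 0).comp hu
    rwa [hK0] at h
  -- Both sides are induced by genuine automorphisms, at `ϰ n g * ϰ n h` and at `ϰ n (g * h)`, whose
  -- distance tends to zero. Identity at the unit holds for the same reason, and inverses then come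
  -- from `α g⁻¹`.
  have hmul : ∀ g h, (α g).comp (α h) = α (g * h) := by
    intro g h
    refine eq_of_rep hF hτ
      (θ := fun n => (αs n (ϰ n g * ϰ n h) : As n →⋆ₐ[ℂ] As n))
      (η := fun n => (αs n (ϰ n (g * h)) : As n →⋆ₐ[ℂ] As n)) ?_ (hα (g * h))
      (hKlim (tendsto_nndist_mul hε hnear g h)) (fun n x hx => hαs n _ _ x hx)
    intro a x hax
    have h1 := hα g _ _ (hα h a x hax)
    have h2 : (fun n => (αs n (ϰ n g * ϰ n h) : As n →⋆ₐ[ℂ] As n) (x n))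
        = fun n => αs n (ϰ n g) (αs n (ϰ n h) (x n)) := by
      funext n
      rw [map_mul]; rfl
    rw [h2]
    exact h1
  have hone : α 1 = StarAlgHom.id ℂ A := by
    refine eq_of_rep hF hτ
      (θ := fun n => (αs n (ϰ n 1) : As n →⋆ₐ[ℂ] As n))
      (η := fun n => (αs n 1 : As n →⋆ₐ[ℂ] As n)) (hα 1) ?_
      (hKlim (tendsto_nndist_one hε hnear)) (fun n x hx => hαs n _ _ x hx)
    intro a x hax
    have h2 : (fun n => (αs n 1 : As n →⋆ₐ[ℂ] As n) (x n)) = x := by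
      funext n
      rw [map_one]; rfl
    rw [h2]
    exact hax
  refine ⟨{ toFun := fun g => StarAlgEquiv.ofStarAlgHom (α g) (α g⁻¹)
              (by rw [hmul, inv_mul_cancel, hone]) (by rw [hmul, mul_inv_cancel, hone]),
            map_one' := ?_, map_mul' := fun g h => ?_ }, hα⟩
  · ext a
    exact DFunLike.congr_fun hone a
  · ext a
    exact (DFunLike.congr_fun (hmul g h) a).symm

theorem enorm_sub_le_of_rep (hF : IsAdmissible F)
    (hτ : Tendsto (fun n => (τ n).extent) U (𝓝 0)) (hε : Tendsto ε U (𝓝 0))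
    (hnear : ∀ n, IsNearIsometricIso (ε n) (ς n) (ϰ n)) (hK : Continuous K)
    (hαs : ∀ n (g g' : Gs n) (a : selfAdjoint (As n)), (As n).L a ≠ ∞ →
      ‖αs n g (a : As n) - αs n g' (a : As n)‖ₑ ≤ K (nndist g g') * (As n).L a)
    {α : G →* (A ≃⋆ₐ[ℂ] A)}
    (hα : ∀ g a x, Rep U τ a x → Rep U τ (α g a) (fun n => αs n (ϰ n g) (x n)))
    (g h : G) (a : selfAdjoint A) (ha : A.L a ≠ ∞) :
    ‖α g (a : A) - α h (a : A)‖ₑ ≤ K (nndist g h) * A.L a := by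
  lift A.L a to ℝ≥0 using ha with l hl
  have hKlim : Tendsto (fun n => K (nndist (ϰ n g) (ϰ n h))) U (𝓝 (K (nndist g h))) :=
    (hK.tendsto _).comp (tendsto_nndist_map hε hnear g h)
  have key : ∀ M : ℝ≥0, K (nndist g h) < M → ‖α g (a : A) - α h (a : A)‖ ≤ M * l := fun M hM => by
    refine norm_sub_le_of_eventually hF hτ (α := (α g : A →⋆ₐ[ℂ] A)) (β := (α h : A →⋆ₐ[ℂ] A))
      (θ := fun n => (αs n (ϰ n g) : As n →⋆ₐ[ℂ] As n))
      (η := fun n => (αs n (ϰ n h) : As n →⋆ₐ[ℂ] As n)) (hα g) (hα h) ?_ hl.ge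
    filter_upwards [hKlim.eventually_le_const hM] with n hn x k hx _
    have h := (hαs n _ _ x (ne_top_of_le_ne_top ENNReal.coe_ne_top hx)).trans
      (mul_le_mul' (ENNReal.coe_le_coe.2 hn) hx)
    rw [enorm_eq_nnnorm] at h
    exact_mod_cast h
  have hlim : Tendsto (fun t : ℝ≥0 => (t : ℝ) * l) (𝓝[>] (K (nndist g h)))
      (𝓝 (K (nndist g h) * l)) := by
    refine Tendsto.mono_left ?_ nhdsWithin_le_nhds
    have hc : Continuous fun t : ℝ≥0 => (t : ℝ) * l := by fun_prop
    exact hc.tendsto _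
  have h2 := ge_of_tendsto hlim (eventually_mem_nhdsWithin.mono fun t h => key t h)
  rw [enorm_eq_nnnorm]
  exact_mod_cast h2

end LimitActions

/-! ### From the propinquity to tunnels, and the main theorem -/

theorem exists_tunnels_of_propinquity.{u₁} {F : ℝ≥0∞ → ℝ≥0∞ → ℝ≥0∞ → ℝ≥0∞ → ℝ≥0∞}
    {𝒞 : Set (QCMS.{u₁} F)} {𝒯 : TunnelClass.{u₁} F} (h𝒯 : IsAppropriate 𝒯 𝒞)
    {As : ℕ → QCMS.{u₁} F} (hAs : ∀ n, As n ∈ 𝒞) {A : QCMS.{u₁} F} (hA : A ∈ 𝒞)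
    (hlim : Tendsto (fun n => propinquity 𝒯 (As n) A) atTop (𝓝 0)) :
    ∃ τ : ∀ n, Tunnel (As n) A, Tendsto (fun n => (τ n).extent) atTop (𝓝 0) := by
  have hpos : ∀ n : ℕ, ((n : ℝ≥0∞) + 1)⁻¹ ≠ 0 := fun n => by simp
  have h : ∀ n, ∃ τ : Tunnel (As n) A,
      τ.extent ≤ propinquity 𝒯 (As n) A + ((n : ℝ≥0∞) + 1)⁻¹ := by
    intro n
    -- Almost minimizers exist only for a finite infimum; otherwise any tunnel will do.
    by_cases htop : propinquity 𝒯 (As n) A = ∞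
    · obtain ⟨τ, -⟩ := h𝒯.exists_tunnel (hAs n) hA
      exact ⟨τ, by simp [htop]⟩
    · obtain ⟨τ, hτ⟩ := iInf_lt_iff.1 (ENNReal.lt_add_right htop (hpos n))
      obtain ⟨-, hτ⟩ := iInf_lt_iff.1 hτ
      exact ⟨τ, hτ.le⟩
  choose τ hτ using h
  refine ⟨τ, tendsto_of_tendsto_of_tendsto_of_le_of_le tendsto_const_nhds ?_
    (fun _ => zero_le) hτ⟩
  have h1 : Tendsto (fun n : ℕ => ((n : ℝ≥0∞) + 1)⁻¹) atTop (𝓝 0) := by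
    have h2 := (tendsto_add_atTop_iff_nat 1).2 ENNReal.tendsto_inv_nat_nhds_zero
    simpa using h2
  simpa using hlim.add h1

end QMetric

theorem mainTheorem3
    {G : Type v} [Group G] [MetricSpace G] [CompactSpace G] [IsTopologicalGroup G]
    {Gs : ℕ → Type w} [∀ n, Group (Gs n)] [∀ n, MetricSpace (Gs n)]
    [∀ n, CompactSpace (Gs n)] [∀ n, IsTopologicalGroup (Gs n)]
    (ε : ℕ → ℝ) (hε_pos : ∀ n, 0 < ε n) (hε_lim : Tendsto ε atTop (𝓝 0))
    (ς : ∀ n, Gs n → G) (ϰ : ∀ n, G → Gs n)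
    (h_near : ∀ n, QMetric.IsNearIsometricIso (ε n) (ς n) (ϰ n))
    (D : G → ℝ≥0) (hD : Continuous D)
    (K : ℝ≥0 → ℝ≥0) (hK : Continuous K) (hK_zero : K 0 = 0)
    (F : ℝ≥0∞ → ℝ≥0∞ → ℝ≥0∞ → ℝ≥0∞ → ℝ≥0∞) (hF : QMetric.IsAdmissible F)
    (𝒞 : Set (QMetric.QCMS.{u} F)) (𝒯 : QMetric.TunnelClass.{u} F)
    (h𝒯 : QMetric.IsAppropriate 𝒯 𝒞)
    (As : ℕ → QMetric.QCMS.{u} F) (hAs : ∀ n, As n ∈ 𝒞)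
    (αs : ∀ n, Gs n →* (As n ≃⋆ₐ[ℂ] As n))
    (hαs_lip : ∀ n (g : Gs n), QMetric.LipschitzBound (D (ς n g)) (As n).L (As n).L
      (αs n g : As n →⋆ₐ[ℂ] As n))
    (hαs_cont : ∀ n (g g' : Gs n) (a : selfAdjoint (As n)), (As n).L a ≠ ∞ →
      ‖αs n g (a : As n) - αs n g' (a : As n)‖ₑ ≤ K (nndist g g') * (As n).L a)
    (A : QMetric.QCMS.{u} F) (hA : A ∈ 𝒞)
    (h_lim : Tendsto (fun n => QMetric.propinquity 𝒯 (As n) A) atTop (𝓝 0)) :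
    ∃ α : G →* (A ≃⋆ₐ[ℂ] A),
      (∀ a : A, Continuous fun g : G => α g a) ∧
      (∀ g : G, QMetric.IsLipschitz A.L A.L (α g : A →⋆ₐ[ℂ] A)) ∧
      (∀ g : G, QMetric.LipschitzBound (D g) A.L A.L (α g : A →⋆ₐ[ℂ] A)) ∧
      (∀ g : G,
        liminf (fun n => QMetric.mkLength (As n).L (αs n (ϰ n g))) atTop
            ≤ QMetric.mkLength A.L (α g) ∧
        QMetric.mkLength A.L (α g)
            ≤ limsup (fun n => QMetric.mkLength (As n).L (αs n (ϰ n g))) atTop) ∧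
      (∀ (g h : G) (a : selfAdjoint A), A.L a ≠ ∞ →
        ‖α g (a : A) - α h (a : A)‖ₑ ≤ A.L a * K (nndist g h)) ∧
      ((∀ g : G, D g ≤ 1) → ∀ g : G, QMetric.IsFullQuantumIsometry A.L A.L (α g)) ∧
      ((∀ n, QMetric.IsErgodic (αs n)) → QMetric.IsErgodic α) := by
  obtain ⟨τ, hτ⟩ := QMetric.exists_tunnels_of_propinquity h𝒯 hAs hA h_lim
  let U : Ultrafilter ℕ := hyperfilter ℕ
  have hU : (U : Filter ℕ) ≤ atTop := Nat.hyperfilter_le_atTop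
  replace hτ := hτ.mono_left hU
  have hε := hε_lim.mono_left hU
  -- The Lipschitz constants are evaluated at `ς n (ϰ n g)`, which tends to `g`; continuity of `D`
  -- gives the exact constant `D g` in the limit.
  have hk : ∀ g, Tendsto (fun n => D (ς n (ϰ n g))) U (𝓝 (D g)) := by
    intro g
    refine (hD.tendsto g).comp (tendsto_iff_dist_tendsto_zero.2 ?_)
    exact squeeze_zero (fun _ => dist_nonneg) (fun n => (h_near n).inv₂ g) hε
  obtain ⟨α, hα⟩ := QMetric.exists_limit_action hF hU hτ hε h_near hK hK_zero hk
    (fun n g => hαs_lip n (ϰ n g)) hαs_cont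
  have hlip : ∀ g, QMetric.LipschitzBound (D g) A.L A.L (α g : A →⋆ₐ[ℂ] A) := fun g =>
    QMetric.lipschitzBound_of_tendsto hF hτ (fun n => hαs_lip n (ϰ n g)) (hk g) (hα g)
  have hcont := QMetric.enorm_sub_le_of_rep hF hτ hε h_near hK hαs_cont hα
  refine ⟨α, QMetric.continuous_of_enorm_sub_le hK hK_zero hcont, fun g a ha => ?_, hlip,
    fun g => ⟨QMetric.liminf_le_mkLength hF hU hτ (hα g), QMetric.mkLength_le_limsup hF hU hτ (hα g)⟩,
    fun g h a ha => ?_, fun hD1 g a => ?_,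
    QMetric.isErgodic_of_rep hF hU hτ hε h_near hK hK_zero hαs_cont hα⟩
  · exact ne_top_of_le_ne_top (ENNReal.mul_ne_top ENNReal.coe_ne_top ha) (hlip g a ha)
  · rw [mul_comm]
    exact hcont g h a ha
  · have hle : ∀ (g : G) (a : selfAdjoint A),
        A.L (QMetric.saMap (α g : A →⋆ₐ[ℂ] A) a) ≤ A.L a := by
      intro g a
      by_cases ha : A.L a = ∞
      · rw [ha]; exact le_top
      · refine (hlip g a ha).trans (mul_le_of_le_one_left' ?_)
        exact_mod_cast hD1 g
    refine le_antisymm (hle g a) ?_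
    -- The reverse inequality is the contraction property of the inverse automorphism.
    have h := hle g⁻¹ (QMetric.saMap (α g : A →⋆ₐ[ℂ] A) a)
    have e : QMetric.saMap (α g⁻¹ : A →⋆ₐ[ℂ] A) (QMetric.saMap (α g : A →⋆ₐ[ℂ] A) a) = a := by
      refine Subtype.ext ?_
      change α g⁻¹ (α g (a : A)) = a
      have : (α g⁻¹ * α g) (a : A) = a := by
        rw [← map_mul, inv_mul_cancel, map_one]; rfl
      exact this
    rwa [e] at h
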